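/- Let $1\le m\le d$, let $\lambda=(\lambda_1,\dots,\lambda_d)$ and $\tau=(\tau_1,\dots,\tau_d)$ be real vectors, and for $r>0$ let $$f(\lambda,\tau,r)=\int_{S^{d-1}(r)}\exp\Bigl(\sum_{i=1}^d\lambda_it_i^2+\sum_{i=1}^d\tau_it_i\Bigr)\,d\mathbf t ,$$ where $S^{d-1}(r)=\{\mathbf t\in\mathbb R^d: t_1^2+\dots+t_d^2=r^2\}$ and $d\mathbf t$ is its volume element (of total mass $r^{d-1}S_{d-1}$; counting measure if $d=1$). Put $S_{m-1}=\mathrm{Vol}(S^{m-1}(1))=2\pi^{m/2}/\Gamma(m/2)$. Assume $$0>\lambda_1=\dots=\lambda_m>\lambda_{m+1}\ge\dots\ge\lambda_d .$$ Then the partial derivatives $\partial_{\lambda_j}f$ and $\partial_{\tau_j}f$ exist for all $r>0$, and the following holds, where $o(1)$ refers to $r\to\infty$ with $\lambda,\tau$ fixed. (a) If $\tau_1=\dots=\tau_m=0$, then \begin{align*} f(\lambda,\tau,r)&=r^{m-1}S_{m-1}\exp\Bigl(r^2\lambda_1-\sum_{i=m+1}^d\frac{\tau_i^2}{4(\lambda_i-\lambda_1)}\Bigr)\frac{\pi^{(d-m)/2}}{\prod_{i=m+1}^d(\lambda_1-\lambda_i)^{1/2}}(1+o(1)),\\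 \partial_{\lambda_j}f(\lambda,\tau,r)&=\frac{r^2}{m}f(\lambda,\tau,r)(1+o(1)),\quad j\le m,\\ \partial_{\tau_j}f(\lambda,\tau,r)&=0\ \text{ for all } r>0,\quad j\le m,\\ \partial_{\tau_j}f(\lambda,\tau,r)&=-\frac{\tau_j}{2(\lambda_j-\lambda_1)}f(\lambda,\tau,r)(1+o(1)),\quad j>m,\\ \partial_{\lambda_j}f(\lambda,\tau,r)&=\Bigl(\frac1{2(\lambda_1-\lambda_j)}+\frac{\tau_j^2}{4(\lambda_j-\lambda_1)^2}\Bigr)f(\lambda,\tau,r)(1+o(1)),\quad j>m. \end{align*} (b) If $(\tau_1,\dots,\tau_m)\ne(0,\dots,0)$ and $\gamma=(\tau_1^2+\dots+\tau_m^2)^{1/2}$, then \begin{align*} f(\lambda,\tau,r)&=\exp\Bigl(r^2\lambda_1+r\gamma-\sum_{i=m+1}^d\frac{\tau_i^2}{4(\lambda_i-\lambda_1)}\Bigr)\Bigl(\frac{2r}{\gamma}\Bigr)^{(m-1)/2}\frac{\pi^{(d-1)/2}}{\prod_{i=m+1}^d(\lambda_1-\lambda_i)^{1/2}}(1+o(1)),\\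 \partial_{\tau_j}f(\lambda,\tau,r)&=r\frac{\tau_j}{\gamma}f(\lambda,\tau,r)(1+o(1)),\quad j\le m,\ \tau_j\ne0,\\ \partial_{\lambda_j}f(\lambda,\tau,r)&=r^2\frac{\tau_j^2}{\gamma^2}f(\lambda,\tau,r)(1+o(1)),\quad j\le m,\ \tau_j\ne0,\\ \partial_{\tau_j}f(\lambda,\tau,r)&=0\ \text{ for all } r>0,\quad j\le m,\ \tau_j=0,\\ \partial_{\lambda_j}f(\lambda,\tau,r)&=\frac r\gamma f(\lambda,\tau,r)(1+o(1)),\quad j\le m,\ \tau_j=0,\\ \partial_{\tau_j}f(\lambda,\tau,r)&=-\frac{\tau_j}{2(\lambda_j-\lambda_1)}f(\lambda,\tau,r)(1+o(1)),\quad j>m,\\ \partial_{\lambda_j}f(\lambda,\tau,r)&=\Bigl(\frac1{2(\lambda_1-\lambda_j)}+\frac{\tau_j^2}{4(\lambda_j-\lambda_1)^2}\Bigr)f(\lambda,\tau,r)(1+o(1)),\quad j>m. \end{align*} -/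

import Mathlib

open MeasureTheory Filter Asymptotics

noncomputable section

namespace FisherBingham

/-- The volume element of the sphere `S^{d-1}(r)` of radius `r` centred at the origin, as a measure
on `ℝ^d`: the image of the surface measure of the unit sphere under `t ↦ r t`, times `r^{d-1}`.
(For `d = 1` it is the counting measure on `{r, -r}`.) -/
def sphereVolume (d : ℕ) (r : ℝ) : Measure (EuclideanSpace ℝ (Fin d)) :=
  ENNReal.ofReal (r ^ (d - 1)) •
    ((volume : Measure (EuclideanSpace ℝ (Fin d))).toSphere.map
      (fun t : Metric.sphere (0 : EuclideanSpace ℝ (Fin d)) 1 =>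
        r • (t : EuclideanSpace ℝ (Fin d))))

/-- The volume `S_{n-1} = 2 π^{n/2} / Γ(n/2)` of the unit sphere of `ℝ^n`. -/
def unitSphereVolume (n : ℕ) : ℝ :=
  2 * Real.pi ^ ((n : ℝ) / 2) / Real.Gamma ((n : ℝ) / 2)

/-- The Fisher-Bingham integral `f(λ, τ, r)`. -/
def integral {d : ℕ} (lam tau : Fin d → ℝ) (r : ℝ) : ℝ :=
  ∫ t, Real.exp (∑ i, lam i * t i ^ 2 + ∑ i, tau i * t i) ∂(sphereVolume d r)

/-- The partial derivative of `f` with respect to `λ_j` at `(λ, τ, r)`. -/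
def derivLam {d : ℕ} (lam tau : Fin d → ℝ) (j : Fin d) (r : ℝ) : ℝ :=
  deriv (fun s => integral (Function.update lam j s) tau r) (lam j)

/-- The partial derivative of `f` with respect to `τ_j` at `(λ, τ, r)`. -/
def derivTau {d : ℕ} (lam tau : Fin d → ℝ) (j : Fin d) (r : ℝ) : ℝ :=
  deriv (fun s => integral lam (Function.update tau j s) r) (tau j)

end FisherBingham

end

/-! On the sphere of radius `r` the form `lam₁ * ‖t‖ ^ 2` is constant. After removing it, the
exponent is linear in the first `m` coordinates and a negative definite quadratic plus a linear term
in the others. Hence the mass concentrates where the linear part is maximal and the last `d - m`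
coordinates stay bounded: Laplace's method on a sphere.

The sphere is parametrised by central projection: a point is `r • (θ, z) / ‖(θ, z)‖`, with `θ` on
the unit sphere of the coordinates in `P` and `z` in a vector space (`integral_toSphere_gnomonic`,
with density `‖(θ, z)‖⁻¹ ^ d`). This chart covers the sphere up to a null set, so no localisation is
needed. Writing `z i = scale i / r * a i`, the normalised integrand converges pointwise to a
Gaussian in `a` times a function of `θ`, and one bound uniform in `r ≥ 1` gives dominated
convergence (`tendsto_integral_exp_phase`).

The partial derivatives of `f` are the moments of `t j` and `t j ^ 2`, so the same limit theorem
with different test functions yields all the asymptotics.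

If the first `m` entries of `tau` vanish, `P` is the set of these indices: `θ` is uniform on the
unit sphere of dimension `m - 1` and the other coordinates have scale `1`. Otherwise an isometry
turns the linear part into `γ * t i₀` (`exists_adapted_isometry`) and `P = {i₀}`. Then `θ = ±1`,
only `θ = 1` survives, and the remaining `m - 1` directions fluctuate on the scale `√r`, since `γ *
r * (1 / ρ - 1)` with `ρ = ‖(θ, z)‖` tends to `-γ / 2` times the sum of their squares. -/

noncomputable section

namespace FisherBingham

open Metric Set Topology

/-! ### Polar coordinates. -/

section Polar

variable {E : Type*} [NormedAddCommGroup E] [NormedSpace ℝ E] [MeasurableSpace E] [BorelSpace E]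
  [FiniteDimensional ℝ E]

/-- Integration in polar coordinates. -/
theorem lintegral_polar [Nontrivial E] (μ : Measure E) [μ.IsAddHaarMeasure] {H : E → ENNReal}
    (hH : Measurable H) :
    ∫⁻ x, H x ∂μ = ∫⁻ ω, (∫⁻ s in Ioi (0 : ℝ),
      ENNReal.ofReal (s ^ (Module.finrank ℝ E - 1)) * H (s • (ω : E))) ∂μ.toSphere := by
  have hmeas : Measurable fun p : sphere (0 : E) 1 × Ioi (0 : ℝ) => H ((p.2 : ℝ) • (p.1 : E)) :=
    hH.comp (by fun_prop)
  calc ∫⁻ x, H x ∂μ = ∫⁻ x : ({(0 : E)}ᶜ : Set E), H x.1 ∂(μ.comap (↑)) := by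
        rw [lintegral_subtype_comap (measurableSet_singleton _).compl, restrict_compl_singleton]
    _ = ∫⁻ p, H ((p.2 : ℝ) • (p.1 : E))
          ∂μ.toSphere.prod (Measure.volumeIoiPow (Module.finrank ℝ E - 1)) := by
        rw [← μ.measurePreserving_homeomorphUnitSphereProd.lintegral_comp hmeas]
        refine lintegral_congr fun x => ?_
        have hx : ‖(x : E)‖ ≠ 0 := norm_ne_zero_iff.2 x.2
        simp [smul_smul, hx]
    _ = _ := by
        rw [lintegral_prod _ hmeas.aemeasurable]
        refine lintegral_congr fun ω => ?_
        rw [Measure.volumeIoiPow, lintegral_withDensity_eq_lintegral_mul _ (by fun_prop)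
          (show Measurable fun y : Ioi (0 : ℝ) => H ((y : ℝ) • (ω : E)) from hH.comp (by fun_prop)),
          ← lintegral_subtype_comap measurableSet_Ioi]
        rfl

end Polar

/-! ### Diagonal scalings of Lebesgue measure. -/

section Scaling

variable {ι : Type*} [Fintype ι]

theorem smul_map_mul_volume_pi {D : ι → ℝ} (hD : ∀ i, 0 < D i) :
    ENNReal.ofReal (∏ i, D i) • Measure.map (fun z i => D i * z i) (volume : Measure (ι → ℝ)) =
      volume := by
  classical
  have hdet : (Matrix.diagonal D).det = ∏ i, D i := Matrix.det_diagonal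
  have hpos : 0 < ∏ i, D i := Finset.prod_pos fun i _ => hD i
  have h := Real.smul_map_diagonal_volume_pi (D := D) (by rw [hdet]; exact hpos.ne')
  rw [hdet, abs_of_pos hpos] at h
  convert h using 3
  ext z i
  simp [Matrix.mulVec_diagonal]

theorem lintegral_pi_scale {D : ι → ℝ} (hD : ∀ i, 0 < D i) {h : (ι → ℝ) → ENNReal}
    (hh : Measurable h) :
    ∫⁻ y, h y = ENNReal.ofReal (∏ i, D i) * ∫⁻ z : ι → ℝ, h fun i => D i * z i := by
  conv_lhs => rw [← smul_map_mul_volume_pi hD]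
  rw [lintegral_smul_measure, lintegral_map hh (by fun_prop), smul_eq_mul]

end Scaling

/-! ### Splitting the coordinates along a predicate. -/

section Join

variable {ι : Type*} {P : ι → Prop} [DecidablePred P]

/-- The vector with prescribed coordinates in `P` and outside `P`. -/
def join (x : EuclideanSpace ℝ {i // P i}) (y : {i // ¬ P i} → ℝ) : EuclideanSpace ℝ ι :=
  WithLp.toLp 2 fun i => if h : P i then x ⟨i, h⟩ else y ⟨i, h⟩

theorem join_apply_of_pos (x : EuclideanSpace ℝ {i // P i}) (y : {i // ¬ P i} → ℝ) {i : ι}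
    (h : P i) : join x y i = x ⟨i, h⟩ := by
  simp [join, h]

theorem join_apply_of_neg (x : EuclideanSpace ℝ {i // P i}) (y : {i // ¬ P i} → ℝ) {i : ι}
    (h : ¬ P i) : join x y i = y ⟨i, h⟩ := by
  simp [join, h]

@[fun_prop]
theorem continuous_join :
    Continuous fun p : EuclideanSpace ℝ {i // P i} × ({i // ¬ P i} → ℝ) => join p.1 p.2 := by
  refine (PiLp.continuous_toLp 2 _).comp (continuous_pi fun i => ?_)
  by_cases h : P i <;> simp only [h, dite_true, dite_false] <;> fun_prop

theorem norm_sq_join [Fintype ι] (x : EuclideanSpace ℝ {i // P i}) (y : {i // ¬ P i} → ℝ) :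
    ‖join x y‖ ^ 2 = ‖x‖ ^ 2 + ∑ i, y i ^ 2 := by
  rw [EuclideanSpace.real_norm_sq_eq, EuclideanSpace.real_norm_sq_eq,
    ← Fintype.sum_subtype_add_sum_subtype P]
  congr 1
  · exact Finset.sum_congr rfl fun i _ => by rw [join_apply_of_pos x y i.2]
  · exact Finset.sum_congr rfl fun i _ => by rw [join_apply_of_neg x y i.2]

theorem smul_join (s : ℝ) (x : EuclideanSpace ℝ {i // P i}) (y : {i // ¬ P i} → ℝ) :
    s • join x y = join (s • x) (s • y) := by
  ext i
  by_cases h : P i <;> simp [join, h]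

/-- The projection to the coordinates in `P`. -/
def proj (P : ι → Prop) [DecidablePred P] (t : EuclideanSpace ℝ ι) : EuclideanSpace ℝ {i // P i} :=
  WithLp.toLp 2 fun i => t i

@[simp]
theorem proj_join (x : EuclideanSpace ℝ {i // P i}) (y : {i // ¬ P i} → ℝ) :
    proj P (join x y) = x := by
  ext i
  simp [proj, join, i.2]

theorem proj_smul (s : ℝ) (t : EuclideanSpace ℝ ι) : proj P (s • t) = s • proj P t := by
  ext i
  simp [proj]

@[fun_prop]
theorem continuous_proj : Continuous (proj P : EuclideanSpace ℝ ι → _) :=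
  (PiLp.continuous_toLp 2 _).comp (by fun_prop)

theorem lintegral_join [Fintype ι] {H : EuclideanSpace ℝ ι → ENNReal} (hH : Measurable H) :
    ∫⁻ t, H t = ∫⁻ x : EuclideanSpace ℝ {i // P i}, ∫⁻ y : {i // ¬ P i} → ℝ, H (join x y) := by
  have e1 := (EuclideanSpace.volume_preserving_symm_measurableEquiv_toLp ι).symm
  have e2 := (EuclideanSpace.volume_preserving_symm_measurableEquiv_toLp {i // P i})
  have e3 := (volume_preserving_piEquivPiSubtypeProd (fun _ : ι => ℝ) P).symm
  have m1 : Measurable fun x : {i // P i} → ℝ =>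
      ∫⁻ y : {i // ¬ P i} → ℝ, H (join (WithLp.toLp 2 x) y) := by
    refine Measurable.lintegral_prod_right' (f := fun p : ({i // P i} → ℝ) × ({i // ¬ P i} → ℝ) =>
      H (join (WithLp.toLp 2 p.1) p.2)) (hH.comp ?_)
    exact (continuous_join.comp (((PiLp.continuous_toLp 2 _).comp continuous_fst).prodMk
      continuous_snd)).measurable
  have m2 : Measurable fun p : ({i // P i} → ℝ) × ({i // ¬ P i} → ℝ) =>
      H ((MeasurableEquiv.toLp 2 (ι → ℝ)).symm.symm
        ((MeasurableEquiv.piEquivPiSubtypeProd (fun _ => ℝ) P).symm p)) :=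
    (hH.comp e1.measurable).comp e3.measurable
  rw [← e1.lintegral_comp hH, ← e3.lintegral_comp (f := fun x => H ((MeasurableEquiv.toLp 2 (ι → ℝ)).symm.symm x))
      (hH.comp e1.measurable),
    Measure.volume_eq_prod, lintegral_prod _ m2.aemeasurable]
  exact (e2.lintegral_comp m1).symm

end Join

/-! ### Radial integrals of Gamma type. -/

theorem lintegral_Ioi_scale {c : ℝ} (hc : 0 < c) {h : ℝ → ENNReal} (hh : Measurable h) :
    ∫⁻ u in Ioi (0 : ℝ), h u = ENNReal.ofReal c * ∫⁻ s in Ioi (0 : ℝ), h (c * s) := by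
  rw [← lintegral_indicator measurableSet_Ioi, ← lintegral_indicator measurableSet_Ioi]
  conv_lhs => rw [← Real.smul_map_volume_mul_left hc.ne']
  rw [lintegral_smul_measure, lintegral_map (hh.indicator measurableSet_Ioi) (by fun_prop),
    abs_of_pos hc, smul_eq_mul]
  congr 2
  ext s
  simp [indicator, hc]

/-- Substituting `u = c * s`, the factor `c ^ N` absorbs the Jacobian. The radial integral thus does
not depend on the direction through `c`. -/
theorem lintegral_pow_mul_exp_neg_mul {c : ℝ} (hc : 0 < c) {N : ℕ} (hN : N ≠ 0) :
    ∫⁻ s in Ioi (0 : ℝ), ENNReal.ofReal (s ^ (N - 1)) *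
        ENNReal.ofReal (Real.exp (-(s * c)) * c ^ N) =
      ∫⁻ s in Ioi (0 : ℝ), ENNReal.ofReal (s ^ (N - 1)) * ENNReal.ofReal (Real.exp (-s)) := by
  conv_rhs => rw [lintegral_Ioi_scale hc (by fun_prop)]
  rw [← lintegral_const_mul _ (by fun_prop)]
  refine setLIntegral_congr_fun measurableSet_Ioi fun s hs => ?_
  have hs : 0 < s := hs
  obtain ⟨n, rfl⟩ := Nat.exists_eq_succ_of_ne_zero hN
  simp only [Nat.succ_eq_add_one, Nat.add_sub_cancel]
  rw [← ENNReal.ofReal_mul (by positivity), ← ENNReal.ofReal_mul (by positivity),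
    ← ENNReal.ofReal_mul (by positivity)]
  congr 1
  rw [mul_comm c s]
  ring

theorem lintegral_pow_mul_exp_neg_ne_zero (n : ℕ) :
    ∫⁻ s in Ioi (0 : ℝ), ENNReal.ofReal (s ^ n) * ENNReal.ofReal (Real.exp (-s)) ≠ 0 := by
  rw [← pos_iff_ne_zero, setLIntegral_pos_iff (by fun_prop)]
  have : (Function.support fun s : ℝ =>
      ENNReal.ofReal (s ^ n) * ENNReal.ofReal (Real.exp (-s))) ∩ Ioi 0 = Ioi 0 := by
    refine inter_eq_right.2 fun s hs => ?_
    have hs : 0 < s := hs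
    have : 0 < s ^ n := by positivity
    simpa [Real.exp_pos] using this
  rw [this]
  simp

theorem lintegral_pow_mul_exp_neg_ne_top (n : ℕ) :
    ∫⁻ s in Ioi (0 : ℝ), ENNReal.ofReal (s ^ n) * ENNReal.ofReal (Real.exp (-s)) ≠ ⊤ := by
  have h := Real.GammaIntegral_convergent (s := (n : ℝ) + 1) (by positivity)
  refine (lt_of_le_of_lt (le_of_eq ?_) h.lintegral_lt_top).ne
  refine setLIntegral_congr_fun measurableSet_Ioi fun s hs => ?_
  have hs : 0 < s := hs
  simp only [add_sub_cancel_right, Real.rpow_natCast]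
  rw [← ENNReal.ofReal_mul (by positivity), mul_comm]

/-! ### Surface measure in gnomonic coordinates. -/

section Gnomonic

variable {ι : Type*} [Fintype ι] {P : ι → Prop} [DecidablePred P]

/-- The central projection of `(x, y)` to the unit sphere. -/
def gnomonic (x : EuclideanSpace ℝ {i // P i}) (y : {i // ¬ P i} → ℝ) : EuclideanSpace ℝ ι :=
  ‖join x y‖⁻¹ • join x y

theorem norm_join_pos {x : EuclideanSpace ℝ {i // P i}} (hx : x ≠ 0) (y : {i // ¬ P i} → ℝ) :
    0 < ‖join x y‖ := by
  refine norm_pos_iff.2 fun h => hx ?_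
  rw [← proj_join x y, h]
  ext
  simp [proj]


theorem measurable_join_right (x : EuclideanSpace ℝ {i // P i}) :
    Measurable fun y : {i // ¬ P i} → ℝ => join x y :=
  (continuous_join.comp (Continuous.prodMk_right x)).measurable

/-- The exceptional points lie on a proper linear subspace, and the cone over them is Lebesgue null.
-/
theorem ae_toSphere_proj_ne_zero [Nonempty {i // P i}] :
    ∀ᵐ ω : sphere (0 : EuclideanSpace ℝ ι) 1 ∂(volume : Measure (EuclideanSpace ℝ ι)).toSphere,
      proj P (ω : EuclideanSpace ℝ ι) ≠ 0 := by
  let S : Submodule ℝ (EuclideanSpace ℝ ι) :=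
    { carrier := {t | ∀ i, P i → t i = 0}
      add_mem' := fun {a b} ha hb i hi => by simp [ha i hi, hb i hi]
      zero_mem' := fun i _ => by simp
      smul_mem' := fun c a ha i hi => by simp [ha i hi] }
  have hS : S ≠ ⊤ := by
    obtain ⟨i, hi⟩ := ‹Nonempty {i // P i}›
    classical
    intro h
    have : EuclideanSpace.single i (1 : ℝ) ∈ S := by rw [h]; trivial
    simpa using this i hi
  have hnull := Measure.addHaar_submodule (volume : Measure (EuclideanSpace ℝ ι)) S hS
  have hmeas : MeasurableSet {ω : sphere (0 : EuclideanSpace ℝ ι) 1 |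
      ¬ proj P (ω : EuclideanSpace ℝ ι) ≠ 0} := by
    simp only [not_not]
    exact (measurableSet_singleton _).preimage
      ((continuous_proj (P := P)).comp continuous_subtype_val).measurable
  rw [ae_iff, Measure.toSphere_apply' _ hmeas]
  refine mul_eq_zero_of_right _ (measure_mono_null ?_ hnull)
  rintro _ ⟨s, -, _, ⟨ω, hω, rfl⟩, rfl⟩
  refine S.smul_mem s fun i hi => ?_
  have : proj P (ω : EuclideanSpace ℝ ι) = 0 := by simpa using hω
  simpa [proj] using congrArg (fun v => v ⟨i, hi⟩) this

/-- The surface measure of the sphere in gnomonic coordinates. -/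
theorem lintegral_toSphere_gnomonic [Nonempty {i // P i}] {φ : EuclideanSpace ℝ ι → ENNReal}
    (hφ : Measurable φ) :
    ∫⁻ ω, φ ω ∂(volume : Measure (EuclideanSpace ℝ ι)).toSphere =
      ∫⁻ θ, (∫⁻ z : {i // ¬ P i} → ℝ, φ (gnomonic (θ : EuclideanSpace ℝ {i // P i}) z) *
        ENNReal.ofReal (‖join (θ : EuclideanSpace ℝ {i // P i}) z‖⁻¹ ^ Fintype.card ι))
        ∂(volume : Measure (EuclideanSpace ℝ {i // P i})).toSphere := by
  have hne : Nonempty ι := ⟨(Classical.arbitrary {i // P i}).1⟩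
  set N := Fintype.card ι with hN
  have hN0 : N ≠ 0 := Fintype.card_ne_zero
  have hcard : N - 1 = Fintype.card {i // P i} - 1 + Fintype.card {i // ¬ P i} := by
    have h1 := Fintype.card_subtype_compl P
    have h2 := Fintype.card_subtype_le P
    have h3 : Fintype.card {i // P i} ≠ 0 := Fintype.card_ne_zero
    omega
  set C := ∫⁻ s in Ioi (0 : ℝ), ENNReal.ofReal (s ^ (N - 1)) * ENNReal.ofReal (Real.exp (-s))
  have hC0 : C ≠ 0 := lintegral_pow_mul_exp_neg_ne_zero _
  have hCtop : C ≠ ⊤ := lintegral_pow_mul_exp_neg_ne_top _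
  -- `H` is chosen so that both iterated integrals carry the same radial factor `C`. In polar
  -- coordinates of the whole space, `‖proj P t‖ ^ N` makes the radial integral independent of the
  -- direction. With `x = s • θ` and `y = s • z`, the quotient of norms becomes `‖join θ z‖⁻¹` and
  -- the Jacobians multiply to `s ^ (N - 1)`. Cancelling `C` compares the two angular integrals.
  let H : EuclideanSpace ℝ ι → ENNReal := fun t => φ (‖t‖⁻¹ • t) *
    ENNReal.ofReal (Real.exp (-‖proj P t‖) * (‖proj P t‖ / ‖t‖) ^ N)
  have hH : Measurable H := by
    have := (continuous_proj (P := P)).measurable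
    refine (hφ.comp (by fun_prop)).mul (by fun_prop)
  have hHs : ∀ (s : ℝ), 0 < s → ∀ t, H (s • t) = φ (‖t‖⁻¹ • t) *
      ENNReal.ofReal (Real.exp (-(s * ‖proj P t‖)) * (‖proj P t‖ / ‖t‖) ^ N) := by
    intro s hs t
    simp only [H, proj_smul, norm_smul, Real.norm_eq_abs, abs_of_pos hs, smul_smul]
    rw [mul_inv, mul_div_mul_left _ _ hs.ne', mul_right_comm, inv_mul_cancel₀ hs.ne', one_mul]
  have h1 : ∫⁻ t, H t = (∫⁻ ω, φ ω ∂(volume : Measure (EuclideanSpace ℝ ι)).toSphere) * C := by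
    rw [lintegral_polar volume hH, ← lintegral_mul_const' _ _ hCtop]
    refine lintegral_congr_ae ?_
    filter_upwards [ae_toSphere_proj_ne_zero (P := P)] with ω hω
    have hc : 0 < ‖proj P (ω : EuclideanSpace ℝ ι)‖ := norm_pos_iff.2 hω
    have hω1 : ‖(ω : EuclideanSpace ℝ ι)‖ = 1 := by simp
    simp only [C]
    rw [← lintegral_pow_mul_exp_neg_mul hc hN0, ← lintegral_const_mul _ (by fun_prop),
      finrank_euclideanSpace]
    refine setLIntegral_congr_fun measurableSet_Ioi fun s hs => ?_
    rw [hHs s hs, hω1, inv_one, one_smul, div_one, mul_left_comm]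
  have h2 : ∫⁻ t, H t = (∫⁻ θ, (∫⁻ z : {i // ¬ P i} → ℝ,
      φ (gnomonic (θ : EuclideanSpace ℝ {i // P i}) z) *
        ENNReal.ofReal (‖join (θ : EuclideanSpace ℝ {i // P i}) z‖⁻¹ ^ N))
        ∂(volume : Measure (EuclideanSpace ℝ {i // P i})).toSphere) * C := by
    have hjm : Measurable fun p : EuclideanSpace ℝ {i // P i} × ({i // ¬ P i} → ℝ) =>
        H (join p.1 p.2) := hH.comp continuous_join.measurable
    rw [lintegral_join (P := P) hH, lintegral_polar volume hjm.lintegral_prod_right',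
      ← lintegral_mul_const' _ _ hCtop]
    refine lintegral_congr fun θ => ?_
    have hθ : ‖(θ : EuclideanSpace ℝ {i // P i})‖ = 1 := by simp
    set A : ({i // ¬ P i} → ℝ) → ENNReal := fun z =>
      φ (gnomonic (θ : EuclideanSpace ℝ {i // P i}) z) *
        ENNReal.ofReal (‖join (θ : EuclideanSpace ℝ {i // P i}) z‖⁻¹ ^ N)
    have hA : Measurable A := by
      have hj := measurable_join_right (θ : EuclideanSpace ℝ {i // P i})
      exact (hφ.comp (by unfold gnomonic; fun_prop)).mul (by fun_prop)
    simp only [C]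
    rw [← lintegral_const_mul _ (by fun_prop)]
    refine setLIntegral_congr_fun measurableSet_Ioi fun s (hs : 0 < s) => ?_
    have hm : Measurable fun y : {i // ¬ P i} → ℝ =>
        H (join (s • (θ : EuclideanSpace ℝ {i // P i})) y) := 
      hH.comp (measurable_join_right _)
    have hz : ∀ z : {i // ¬ P i} → ℝ, H (join (s • (θ : EuclideanSpace ℝ {i // P i}))
        fun i => s * z i) = A z * ENNReal.ofReal (Real.exp (-s)) := by
      intro z
      have : (fun i => s * z i) = s • z := rfl
      rw [this, ← smul_join, hHs s hs, proj_join, hθ, mul_one, one_div, mul_assoc,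
        ← ENNReal.ofReal_mul (by positivity), mul_comm (Real.exp _)]
      rfl
    rw [lintegral_pi_scale (fun _ => hs) hm, lintegral_congr hz, lintegral_mul_const _ hA,
      finrank_euclideanSpace, hcard, pow_add, ENNReal.ofReal_mul (by positivity)]
    simp only [Finset.prod_const, Finset.card_univ]
    ring
  exact (ENNReal.mul_left_inj hC0 hCtop).1 (h1.symm.trans h2)

end Gnomonic

/-! ### Invariance of the surface measure under isometries. -/

section Isometry

variable {ι : Type*} [Fintype ι]

/-- The integrable weight `exp (-‖t‖)` is radial, so the invariance of Lebesgue measure under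
isometries passes to the sphere. -/
theorem lintegral_toSphere_mul [Nonempty ι] {φ : EuclideanSpace ℝ ι → ENNReal}
    (hφ : Measurable φ) :
    ∫⁻ t : EuclideanSpace ℝ ι, φ (‖t‖⁻¹ • t) * ENNReal.ofReal (Real.exp (-‖t‖)) =
      (∫⁻ ω, φ ω ∂(volume : Measure (EuclideanSpace ℝ ι)).toSphere) *
        ∫⁻ s in Ioi (0 : ℝ),
          ENNReal.ofReal (s ^ (Fintype.card ι - 1)) * ENNReal.ofReal (Real.exp (-s)) := by
  have hm : Measurable fun t : EuclideanSpace ℝ ι =>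
      φ (‖t‖⁻¹ • t) * ENNReal.ofReal (Real.exp (-‖t‖)) := (hφ.comp (by fun_prop)).mul (by fun_prop)
  rw [lintegral_polar volume hm,
    ← lintegral_mul_const' _ _ (lintegral_pow_mul_exp_neg_ne_top _)]
  refine lintegral_congr fun ω => ?_
  have hω : ‖(ω : EuclideanSpace ℝ ι)‖ = 1 := by simp
  rw [← lintegral_const_mul _ (by fun_prop), finrank_euclideanSpace]
  refine setLIntegral_congr_fun measurableSet_Ioi fun s (hs : 0 < s) => ?_
  simp only [norm_smul, hω, mul_one, Real.norm_eq_abs, abs_of_pos hs, smul_smul,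
    inv_mul_cancel₀ hs.ne', one_smul]
  ring

theorem lintegral_toSphere_isometry [Nonempty ι]
    (L : EuclideanSpace ℝ ι ≃ₗᵢ[ℝ] EuclideanSpace ℝ ι)
    {φ : EuclideanSpace ℝ ι → ENNReal} (hφ : Measurable φ) :
    ∫⁻ ω, φ (L ω) ∂(volume : Measure (EuclideanSpace ℝ ι)).toSphere =
      ∫⁻ ω, φ ω ∂(volume : Measure (EuclideanSpace ℝ ι)).toSphere := by
  have hm : Measurable fun t : EuclideanSpace ℝ ι =>
      φ (‖t‖⁻¹ • t) * ENNReal.ofReal (Real.exp (-‖t‖)) := (hφ.comp (by fun_prop)).mul (by fun_prop)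
  have h := L.measurePreserving.lintegral_comp hm
  simp only [L.norm_map, ← map_smul] at h
  rw [lintegral_toSphere_mul hφ, lintegral_toSphere_mul (φ := fun t => φ (L t))
    (hφ.comp L.continuous.measurable)] at h
  exact (ENNReal.mul_left_inj (lintegral_pow_mul_exp_neg_ne_zero _)
    (lintegral_pow_mul_exp_neg_ne_top _)).1 h

/-- The surface measure of the unit sphere is invariant under linear isometries. -/
theorem integral_toSphere_isometry [Nonempty ι]
    (L : EuclideanSpace ℝ ι ≃ₗᵢ[ℝ] EuclideanSpace ℝ ι)
    {φ : EuclideanSpace ℝ ι → ℝ} (hφ : Measurable φ) :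
    ∫ ω, φ (L ω) ∂(volume : Measure (EuclideanSpace ℝ ι)).toSphere =
      ∫ ω, φ ω ∂(volume : Measure (EuclideanSpace ℝ ι)).toSphere := by
  have hL : Measurable L := L.continuous.measurable
  -- Equality of image measures transfers the identity to real integrals without any integrability
  -- condition.
  have h : Measure.map (fun ω : sphere (0 : EuclideanSpace ℝ ι) 1 => L ω)
      (volume : Measure (EuclideanSpace ℝ ι)).toSphere =
      Measure.map (fun ω : sphere (0 : EuclideanSpace ℝ ι) 1 => (ω : EuclideanSpace ℝ ι))
      (volume : Measure (EuclideanSpace ℝ ι)).toSphere := by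
    refine Measure.ext_of_lintegral _ fun f hf => ?_
    rw [lintegral_map hf (by fun_prop), lintegral_map hf (by fun_prop)]
    exact lintegral_toSphere_isometry L hf
  rw [← integral_map (φ := fun ω : sphere (0 : EuclideanSpace ℝ ι) 1 => L ω)
    (by fun_prop) hφ.aestronglyMeasurable, h,
    integral_map (by fun_prop) hφ.aestronglyMeasurable]

end Isometry

/-! ### Gnomonic coordinates for real integrals. -/

section Gnomonic

variable {ι : Type*} [Fintype ι] {P : ι → Prop} [DecidablePred P]

theorem integral_toSphere_gnomonic [Nonempty {i // P i}] {φ : EuclideanSpace ℝ ι → ℝ}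
    (hφ : Measurable φ) {D : {i // ¬ P i} → ℝ} (hD : ∀ i, 0 < D i) :
    ∫ ω, φ ω ∂(volume : Measure (EuclideanSpace ℝ ι)).toSphere =
      (∏ i, D i) * ∫ p : sphere (0 : EuclideanSpace ℝ {i // P i}) 1 × ({i // ¬ P i} → ℝ),
        ‖join (p.1 : EuclideanSpace ℝ {i // P i}) (fun i => D i * p.2 i)‖⁻¹ ^ Fintype.card ι *
          φ (gnomonic (p.1 : EuclideanSpace ℝ {i // P i}) fun i => D i * p.2 i)
        ∂((volume : Measure (EuclideanSpace ℝ {i // P i})).toSphere.prod volume) := by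
  set σ := (volume : Measure (EuclideanSpace ℝ {i // P i})).toSphere
  let J : sphere (0 : EuclideanSpace ℝ {i // P i}) 1 × ({i // ¬ P i} → ℝ) → EuclideanSpace ℝ ι :=
    fun p => join (p.1 : EuclideanSpace ℝ {i // P i}) fun i => D i * p.2 i
  have hJ : Measurable J :=
    (continuous_join.comp (by fun_prop : Continuous fun p :
      sphere (0 : EuclideanSpace ℝ {i // P i}) 1 × ({i // ¬ P i} → ℝ) =>
        ((p.1 : EuclideanSpace ℝ {i // P i}), fun i => D i * p.2 i))).measurable
  let G : sphere (0 : EuclideanSpace ℝ {i // P i}) 1 × ({i // ¬ P i} → ℝ) → EuclideanSpace ℝ ι :=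
    fun p => ‖J p‖⁻¹ • J p
  have hG : Measurable G := by fun_prop
  let w : sphere (0 : EuclideanSpace ℝ {i // P i}) 1 × ({i // ¬ P i} → ℝ) → ENNReal :=
    fun p => ENNReal.ofReal (‖J p‖⁻¹ ^ Fintype.card ι)
  have hw : Measurable w := by fun_prop
  have h : Measure.map (fun ω : sphere (0 : EuclideanSpace ℝ ι) 1 => (ω : EuclideanSpace ℝ ι))
      (volume : Measure (EuclideanSpace ℝ ι)).toSphere =
      ENNReal.ofReal (∏ i, D i) • Measure.map G ((σ.prod volume).withDensity w) := by
    refine Measure.ext_of_lintegral _ fun f hf => ?_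
    have hm : Measurable fun p => w p * f (G p) := hw.mul (hf.comp hG)
    rw [lintegral_map hf (by fun_prop), lintegral_smul_measure, lintegral_map hf hG,
      lintegral_withDensity_eq_lintegral_mul _ hw (g := fun p => f (G p)) (hf.comp hG),
      lintegral_toSphere_gnomonic (P := P) hf]
    simp only [Pi.mul_apply, smul_eq_mul]
    rw [lintegral_prod _ hm.aemeasurable, ← lintegral_const_mul _ hm.lintegral_prod_right']
    refine lintegral_congr fun θ => ?_
    have hj := measurable_join_right (θ : EuclideanSpace ℝ {i // P i})
    have hg : Measurable fun z => gnomonic (θ : EuclideanSpace ℝ {i // P i}) z := by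
      unfold gnomonic
      fun_prop
    rw [lintegral_pi_scale hD (h := fun z => f (gnomonic (θ : EuclideanSpace ℝ {i // P i}) z) *
      ENNReal.ofReal (‖join (θ : EuclideanSpace ℝ {i // P i}) z‖⁻¹ ^ Fintype.card ι))
      ((hf.comp hg).mul (by fun_prop))]
    congr 1
    refine lintegral_congr fun z => ?_
    rw [mul_comm]
    rfl
  rw [← integral_map (φ := fun ω : sphere (0 : EuclideanSpace ℝ ι) 1 => (ω : EuclideanSpace ℝ ι))
    (by fun_prop) hφ.aestronglyMeasurable, h, integral_smul_measure,
    integral_map hG.aemeasurable hφ.aestronglyMeasurable,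
    integral_withDensity_eq_integral_toReal_smul hw (by simp [w]),
    ENNReal.toReal_ofReal (Finset.prod_nonneg fun i _ => (hD i).le), smul_eq_mul]
  congr 1
  refine integral_congr_ae (.of_forall fun p => ?_)
  simp only [w, smul_eq_mul]
  rw [ENNReal.toReal_ofReal (by positivity)]
  rfl

end Gnomonic

theorem integral_sphereVolume {d : ℕ} {r : ℝ} (hr : 0 < r) {F : EuclideanSpace ℝ (Fin d) → ℝ}
    (hF : Measurable F) :
    ∫ t, F t ∂(sphereVolume d r) = r ^ (d - 1) *
      ∫ ω, F (r • (ω : EuclideanSpace ℝ (Fin d)))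
        ∂(volume : Measure (EuclideanSpace ℝ (Fin d))).toSphere := by
  rw [sphereVolume, integral_smul_measure, ENNReal.toReal_ofReal (by positivity), smul_eq_mul,
    integral_map (by fun_prop) hF.aestronglyMeasurable]

/-! ### Mass and second moments of the unit sphere. -/

section Mass

variable {ι : Type*} [Fintype ι]

theorem toSphere_real_univ [Nonempty ι] :
    (volume : Measure (EuclideanSpace ℝ ι)).toSphere.real univ =
      unitSphereVolume (Fintype.card ι) := by
  rw [Measure.toSphere_real_apply_univ, finrank_euclideanSpace, measureReal_def,
    EuclideanSpace.volume_ball, unitSphereVolume]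
  have hn : (0 : ℝ) < Fintype.card ι := by exact_mod_cast Fintype.card_pos
  set n := (Fintype.card ι : ℝ) with hn'
  have h1 : Real.sqrt Real.pi ^ Fintype.card ι = Real.pi ^ (n / 2) := by
    rw [Real.sqrt_eq_rpow, ← Real.rpow_natCast, ← Real.rpow_mul Real.pi_pos.le, hn']
    congr 1
    ring
  have hΓ : 0 < Real.Gamma (n / 2) := Real.Gamma_pos_of_pos (by positivity)
  have hp : 0 < Real.pi ^ (n / 2) := by positivity
  rw [h1, Real.Gamma_add_one (by positivity)]
  simp only [ENNReal.ofReal_one, one_pow, one_mul]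
  rw [ENNReal.toReal_ofReal (by positivity)]
  field_simp

theorem integrable_toSphere_of_continuous {φ : EuclideanSpace ℝ ι → ℝ} (hφ : Continuous φ) :
    Integrable (fun ω : sphere (0 : EuclideanSpace ℝ ι) 1 => φ ω)
      (volume : Measure (EuclideanSpace ℝ ι)).toSphere := by
  have : CompactSpace (sphere (0 : EuclideanSpace ℝ ι) 1) :=
    isCompact_iff_compactSpace.1 (isCompact_sphere _ _)
  exact (hφ.comp continuous_subtype_val).integrable_of_hasCompactSupport
    (HasCompactSupport.of_compactSpace _)

/-- Exchanging two coordinates is an isometry, so all second moments agree; the squares of the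
coordinates add up to `1`. -/
theorem integral_toSphere_sq [Nonempty ι] (j : ι) :
    ∫ ω, (ω : EuclideanSpace ℝ ι) j ^ 2 ∂(volume : Measure (EuclideanSpace ℝ ι)).toSphere =
      unitSphereVolume (Fintype.card ι) / Fintype.card ι := by
  classical
  have hsymm : ∀ i, ∫ ω, (ω : EuclideanSpace ℝ ι) i ^ 2
        ∂(volume : Measure (EuclideanSpace ℝ ι)).toSphere =
      ∫ ω, (ω : EuclideanSpace ℝ ι) j ^ 2
        ∂(volume : Measure (EuclideanSpace ℝ ι)).toSphere := by
    intro i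
    have h := integral_toSphere_isometry (LinearIsometryEquiv.piLpCongrLeft 2 ℝ ℝ (Equiv.swap i j))
      (φ := fun t => t j ^ 2) (by fun_prop)
    simpa [LinearIsometryEquiv.piLpCongrLeft_apply, Equiv.piCongrLeft'] using h
  have hsum : ∑ i, ∫ ω, (ω : EuclideanSpace ℝ ι) i ^ 2
      ∂(volume : Measure (EuclideanSpace ℝ ι)).toSphere = unitSphereVolume (Fintype.card ι) := by
    rw [← integral_finsetSum _ fun i _ =>
      integrable_toSphere_of_continuous (φ := fun t : EuclideanSpace ℝ ι => t i ^ 2) (by fun_prop)]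
    have : ∀ ω : sphere (0 : EuclideanSpace ℝ ι) 1, ∑ i, (ω : EuclideanSpace ℝ ι) i ^ 2 = 1 := by
      intro ω
      rw [← EuclideanSpace.real_norm_sq_eq]
      simp
    simp_rw [this]
    rw [integral_const, toSphere_real_univ, smul_eq_mul, mul_one]
  simp_rw [hsymm] at hsum
  rw [Finset.sum_const, Finset.card_univ, nsmul_eq_mul] at hsum
  rw [← hsum, mul_div_cancel_left₀]
  exact_mod_cast Fintype.card_ne_zero

theorem unitSphereVolume_one : unitSphereVolume 1 = 2 := by
  rw [unitSphereVolume, Nat.cast_one, Real.Gamma_one_half_eq, Real.sqrt_eq_rpow]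
  have : 0 < Real.pi ^ ((1 : ℝ) / 2) := by positivity
  field_simp

theorem unitSphereVolume_pos {n : ℕ} (hn : 0 < n) : 0 < unitSphereVolume n := by
  have : 0 < Real.Gamma ((n : ℝ) / 2) := Real.Gamma_pos_of_pos (by positivity)
  unfold unitSphereVolume
  positivity

/-- Each of the two points of `S⁰` has mass one. -/
theorem integral_toSphere_unique [Unique ι] :
    ∫ ω, (if (ω : EuclideanSpace ℝ ι) default = 1 then (1 : ℝ) else 0)
      ∂(volume : Measure (EuclideanSpace ℝ ι)).toSphere = 1 := by
  have hm : Measurable fun t : EuclideanSpace ℝ ι => if t default = 1 then (1 : ℝ) else 0 :=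
    Measurable.ite ((measurableSet_singleton (1 : ℝ)).preimage (by fun_prop)) (by fun_prop)
      (by fun_prop)
  -- The antipodal map exchanges the two points, so they have equal mass, and the total mass is `2`.
  have hneg : ∫ ω, (if (-(ω : EuclideanSpace ℝ ι)) default = 1 then (1 : ℝ) else 0)
      ∂(volume : Measure (EuclideanSpace ℝ ι)).toSphere =
      ∫ ω, (if (ω : EuclideanSpace ℝ ι) default = 1 then (1 : ℝ) else 0)
      ∂(volume : Measure (EuclideanSpace ℝ ι)).toSphere :=
    integral_toSphere_isometry (LinearIsometryEquiv.neg ℝ) hm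
  have hi : ∀ f : sphere (0 : EuclideanSpace ℝ ι) 1 → ℝ, Measurable f → (∀ ω, ‖f ω‖ ≤ 1) →
      Integrable f (volume : Measure (EuclideanSpace ℝ ι)).toSphere := fun f hf hb =>
    Integrable.of_bound hf.aestronglyMeasurable 1 (.of_forall hb)
  have hsum : ∫ ω, ((if (ω : EuclideanSpace ℝ ι) default = 1 then (1 : ℝ) else 0) +
      (if (-(ω : EuclideanSpace ℝ ι)) default = 1 then (1 : ℝ) else 0))
      ∂(volume : Measure (EuclideanSpace ℝ ι)).toSphere = 2 := by
    have : ∀ ω : sphere (0 : EuclideanSpace ℝ ι) 1,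
        ((if (ω : EuclideanSpace ℝ ι) default = 1 then (1 : ℝ) else 0) +
      (if (-(ω : EuclideanSpace ℝ ι)) default = 1 then (1 : ℝ) else 0)) = 1 := by
      intro ω
      have h1 : (ω : EuclideanSpace ℝ ι) default ^ 2 = 1 := by
        have := EuclideanSpace.real_norm_sq_eq (ω : EuclideanSpace ℝ ι)
        simpa using this.symm
      rcases sq_eq_one_iff.1 h1 with h | h
      all_goals simp [h]
      all_goals norm_num
    simp_rw [this]
    rw [integral_const, toSphere_real_univ, Fintype.card_unique, unitSphereVolume_one]
    norm_num
  have hi1 := hi (fun ω => if (ω : EuclideanSpace ℝ ι) default = 1 then (1 : ℝ) else 0)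
    (hm.comp measurable_subtype_coe) fun ω => by split_ifs <;> simp
  have hi2 := hi (fun ω => if (-(ω : EuclideanSpace ℝ ι)) default = 1 then (1 : ℝ) else 0)
    ((hm.comp measurable_neg).comp measurable_subtype_coe) fun ω => by split_ifs <;> simp
  rw [integral_add hi1 hi2] at hsum
  rw [hneg] at hsum
  linarith

end Mass

/-! ### Gaussian integrals. -/

section Gaussian

/-- Completing the square gives mean `ν / (2 * κ)` and variance `1 / (2 * κ)`. The integrands agree
pointwise up to a constant, so `h` may be arbitrary. -/
theorem integral_mul_exp_quadratic {κ : ℝ} (hκ : 0 < κ) (ν : ℝ) (h : ℝ → ℝ) :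
    ∫ x, h x * Real.exp (-κ * x ^ 2 + ν * x) =
      (∫ x, h x ∂ProbabilityTheory.gaussianReal (ν / (2 * κ)) (Real.toNNReal (1 / (2 * κ)))) *
        (Real.sqrt (Real.pi / κ) * Real.exp (ν ^ 2 / (4 * κ))) := by
  have hv : 0 < 1 / (2 * κ) := by positivity
  rw [ProbabilityTheory.integral_gaussianReal_eq_integral_smul (by simpa using hκ),
    ← integral_mul_const]
  congr 1
  ext x
  have hs : Real.sqrt (Real.pi / κ) ≠ 0 := by positivity
  rw [ProbabilityTheory.gaussianPDFReal_def]
  simp only [Real.coe_toNNReal _ hv.le, smul_eq_mul]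
  have e1 : 2 * Real.pi * (1 / (2 * κ)) = Real.pi / κ := by field_simp
  have e2 : Real.exp (-κ * x ^ 2 + ν * x) =
      Real.exp (-(x - ν / (2 * κ)) ^ 2 / (2 * (1 / (2 * κ)))) * Real.exp (ν ^ 2 / (4 * κ)) := by
    rw [← Real.exp_add]
    congr 1
    field_simp
    ring
  rw [e1, e2]
  field_simp

theorem integral_sq_gaussianReal (μ : ℝ) (v : NNReal) :
    ∫ x, x ^ 2 ∂ProbabilityTheory.gaussianReal μ v = v + μ ^ 2 := by
  have h := ProbabilityTheory.variance_eq_sub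
    (ProbabilityTheory.memLp_id_gaussianReal (μ := μ) (v := v) 2)
  rw [ProbabilityTheory.variance_id_gaussianReal] at h
  simp only [Pi.pow_apply, id, ProbabilityTheory.integral_id_gaussianReal] at h
  linarith

variable {ι : Type*} [Fintype ι]

/-- The mass of the Gaussian density `exp (∑ (-κ_i a_i² + ν_i a_i))`. -/
def gaussMass (κ ν : ι → ℝ) : ℝ :=
  ∏ i, (Real.sqrt (Real.pi / κ i) * Real.exp (ν i ^ 2 / (4 * κ i)))

theorem gaussMass_pos {κ : ι → ℝ} (hκ : ∀ i, 0 < κ i) (ν : ι → ℝ) : 0 < gaussMass κ ν :=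
  Finset.prod_pos fun i _ => by have := hκ i; positivity

theorem integral_exp_sum_quadratic {κ : ι → ℝ} (hκ : ∀ i, 0 < κ i) (ν : ι → ℝ) :
    ∫ a : ι → ℝ, Real.exp (∑ i, (-κ i * a i ^ 2 + ν i * a i)) = gaussMass κ ν := by
  simp_rw [Real.exp_sum]
  rw [integral_fintype_prod_volume_eq_prod fun i x => Real.exp (-κ i * x ^ 2 + ν i * x)]
  refine Finset.prod_congr rfl fun i _ => ?_
  simpa using integral_mul_exp_quadratic (hκ i) (ν i) fun _ => 1

theorem integral_comp_mul_exp_sum_quadratic {κ : ι → ℝ} (hκ : ∀ i, 0 < κ i) (ν : ι → ℝ) (j : ι)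
    (h : ℝ → ℝ) :
    ∫ a : ι → ℝ, h (a j) * Real.exp (∑ i, (-κ i * a i ^ 2 + ν i * a i)) =
      (∫ x, h x ∂ProbabilityTheory.gaussianReal (ν j / (2 * κ j))
        (Real.toNNReal (1 / (2 * κ j)))) * gaussMass κ ν := by
  classical
  have e : ∀ a : ι → ℝ, h (a j) * Real.exp (∑ i, (-κ i * a i ^ 2 + ν i * a i)) =
      ∏ i, (if i = j then h (a i) else 1) * Real.exp (-κ i * a i ^ 2 + ν i * a i) := by
    intro a
    rw [Finset.prod_mul_distrib, Real.exp_sum, Finset.prod_ite_eq' Finset.univ j]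
    simp
  simp_rw [e]
  rw [integral_fintype_prod_volume_eq_prod fun i x =>
    (if i = j then h x else 1) * Real.exp (-κ i * x ^ 2 + ν i * x), gaussMass]
  simp_rw [fun i => integral_mul_exp_quadratic (hκ i) (ν i) fun x => if i = j then h x else 1]
  rw [Finset.prod_mul_distrib]
  congr 1
  rw [Finset.prod_eq_single j]
  · simp
  · intro i _ hi
    simp [hi]
  · simp

theorem integral_eval_mul_exp_sum_quadratic {κ : ι → ℝ} (hκ : ∀ i, 0 < κ i) (ν : ι → ℝ) (j : ι) :
    ∫ a : ι → ℝ, a j * Real.exp (∑ i, (-κ i * a i ^ 2 + ν i * a i)) =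
      ν j / (2 * κ j) * gaussMass κ ν := by
  rw [integral_comp_mul_exp_sum_quadratic hκ ν j fun x => x,
    ProbabilityTheory.integral_id_gaussianReal]

theorem integral_eval_sq_mul_exp_sum_quadratic {κ : ι → ℝ} (hκ : ∀ i, 0 < κ i) (ν : ι → ℝ)
    (j : ι) :
    ∫ a : ι → ℝ, a j ^ 2 * Real.exp (∑ i, (-κ i * a i ^ 2 + ν i * a i)) =
      (1 / (2 * κ j) + ν j ^ 2 / (4 * κ j ^ 2)) * gaussMass κ ν := by
  have hj := hκ j
  rw [integral_comp_mul_exp_sum_quadratic hκ ν j fun x => x ^ 2, integral_sq_gaussianReal,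
    Real.coe_toNNReal _ (by positivity)]
  congr 2
  field_simp
  norm_num

end Gaussian

/-! ### Elementary bounds for the domination. -/

section Bounds

theorem one_add_pow_mul_exp_neg_le {c v : ℝ} (hc : 0 < c) (hv : 0 ≤ v) (n : ℕ) :
    (1 + v) ^ n * Real.exp (-(c * v)) ≤ n.factorial * Real.exp c / c ^ n := by
  have h := Real.pow_div_factorial_le_exp (x := c * (1 + v)) (by positivity) n
  rw [div_le_iff₀ (by positivity), mul_pow, mul_add, mul_one, Real.exp_add] at h
  rw [le_div_iff₀ (by positivity), Real.exp_neg, mul_right_comm, ← div_eq_mul_inv,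
    div_le_iff₀ (Real.exp_pos _)]
  linarith

/-- Here `v` will be the size of `a / ρ`, which stays bounded for fixed `r`, so decay in `v` alone
is not integrable in `a`. Together with the Jacobian `ρ⁻¹ ^ n` it becomes decay in `a` itself, as `ρ
* (1 + v) ≥ √(1 + S)`. -/
theorem inv_mul_pow_le_rpow {ρ v S : ℝ} (hρ : 0 < ρ) (hv : 0 ≤ v) (hS : 0 ≤ S)
    (h : 1 + S ≤ ρ ^ 2 * (1 + v)) (n : ℕ) :
    ρ⁻¹ ^ n * ((1 + v) ^ n)⁻¹ ≤ (1 + S) ^ (-(n : ℝ) / 2) := by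
  have h1 : Real.sqrt (1 + S) ≤ ρ * (1 + v) := by
    refine Real.sqrt_le_iff.2 ⟨by positivity, h.trans ?_⟩
    nlinarith [mul_nonneg (sq_nonneg ρ) (mul_nonneg hv (by linarith : 0 ≤ 1 + v))]
  have hs : 0 < Real.sqrt (1 + S) := by positivity
  have e : (1 + S) ^ (-(n : ℝ) / 2) = (Real.sqrt (1 + S) ^ n)⁻¹ := by
    rw [Real.sqrt_eq_rpow, ← Real.rpow_natCast, ← Real.rpow_mul (by positivity),
      ← Real.rpow_neg (by positivity)]
    congr 1
    ring
  rw [e, inv_pow, ← mul_inv, ← mul_pow]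
  gcongr

/-- Equivalent to `(ρ - 1) ^ 2 ≥ 0`. Since `ρ ^ 2 - 1` is a sum of squares, this bounds the loss `1
- ρ⁻¹` below by a quadratic form. -/
theorem one_sub_inv_ge {ρ : ℝ} (hρ : 1 ≤ ρ) : (ρ ^ 2 - 1) / (2 * ρ ^ 2) ≤ 1 - ρ⁻¹ := by
  have : 0 < ρ := by linarith
  rw [div_le_iff₀ (by positivity)]
  have e : (1 - ρ⁻¹) * (2 * ρ ^ 2) = 2 * ρ ^ 2 - 2 * ρ := by field_simp
  rw [e]
  nlinarith [sq_nonneg (ρ - 1)]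

/-- Half of the quadratic term absorbs the linear one by completing the square. -/
theorem sum_quadratic_le {ι : Type*} [Fintype ι] {κ : ι → ℝ} {c : ℝ} (hc : 0 < c)
    (hκ : ∀ i, c ≤ κ i) (ν b : ι → ℝ) :
    ∑ i, (-κ i * b i ^ 2 + ν i * b i) ≤
      -(c / 2 * ∑ i, b i ^ 2) + ∑ i, ν i ^ 2 / (2 * c) := by
  rw [Finset.mul_sum, ← Finset.sum_neg_distrib, ← Finset.sum_add_distrib]
  refine Finset.sum_le_sum fun i _ => ?_
  have h1 : c * b i ^ 2 ≤ κ i * b i ^ 2 := mul_le_mul_of_nonneg_right (hκ i) (sq_nonneg _)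
  have h2 : ν i ^ 2 / (2 * c) - ν i * b i + c / 2 * b i ^ 2 = (ν i - c * b i) ^ 2 / (2 * c) := by
    field_simp
    ring
  have h3 : 0 ≤ (ν i - c * b i) ^ 2 / (2 * c) := by positivity
  linarith

theorem exists_pos_le {ι : Type*} [Finite ι] {κ : ι → ℝ} (hκ : ∀ i, 0 < κ i) :
    ∃ c > 0, ∀ i, c ≤ κ i := by
  cases isEmpty_or_nonempty ι
  · exact ⟨1, one_pos, fun i => isEmptyElim i⟩
  · obtain ⟨i, hi⟩ := Finite.exists_min κ
    exact ⟨κ i, hκ i, hi⟩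

end Bounds

/-! ### Scales of the coordinates. -/

section Scale

variable {ι : Type*} {P : ι → Prop} (M : {i // ¬ P i} → Prop) [DecidablePred M]

/-- The scale of the coordinate `i`: `√r` in the directions `M` and `1` in the others. -/
def scale (r : ℝ) (i : {i // ¬ P i}) : ℝ := if M i then Real.sqrt r else 1

variable {M}

theorem scale_pos {r : ℝ} (hr : 0 < r) (i : {i // ¬ P i}) : 0 < scale M r i := by
  unfold scale
  split_ifs <;> positivity

theorem scale_div_tendsto (i : {i // ¬ P i}) :
    Tendsto (fun r => scale M r i / r) atTop (𝓝 0) := by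
  unfold scale
  split_ifs
  · simp_rw [Real.sqrt_div_self]
    exact (tendsto_inv_atTop_zero.comp Real.tendsto_sqrt_atTop)
  · exact tendsto_const_nhds.div_atTop tendsto_id

/-- This decides which coordinates are seen by the expansion of `r / ρ`: those on the scale `√r`
contribute at order one, those on the scale `1` do not. -/
theorem mul_sq_scale_div_tendsto (i : {i // ¬ P i}) :
    Tendsto (fun r => r * (scale M r i / r) ^ 2) atTop (𝓝 (if M i then 1 else 0)) := by
  unfold scale
  split_ifs
  · refine tendsto_const_nhds.congr' ?_
    filter_upwards [eventually_gt_atTop 0] with r hr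
    rw [div_pow, Real.sq_sqrt hr.le]
    field_simp
  · refine tendsto_inv_atTop_zero.congr' ?_
    filter_upwards [eventually_gt_atTop 0] with r hr
    field_simp

end Scale

/-! ### Rescaled chart and Laplace's method. -/

section Chart

variable {ι : Type*} [Fintype ι] {P : ι → Prop} [DecidablePred P]
  (M : {i // ¬ P i} → Prop) [DecidablePred M]

/-- The point of the sphere of radius `r` with rescaled gnomonic coordinates `(θ, a)`. -/
def chart (r : ℝ) (θ : EuclideanSpace ℝ {i // P i}) (a : {i // ¬ P i} → ℝ) : EuclideanSpace ℝ ι :=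
  r • gnomonic θ fun i => scale M r i / r * a i

/-- The normalising factor of the gnomonic chart. -/
def chartNorm (r : ℝ) (a : {i // ¬ P i} → ℝ) : ℝ :=
  Real.sqrt (1 + ∑ i, (scale M r i / r * a i) ^ 2)

/-- The exponent of the Fisher-Bingham density in adapted coordinates, up to a constant. -/
def phase (γ : ℝ) (i₀ : {i // P i}) (κ ν : {i // ¬ P i} → ℝ) (t : EuclideanSpace ℝ ι) : ℝ :=
  γ * t i₀ + ∑ i, if M i then 0 else (-κ i * t i ^ 2 + ν i * t i)

variable {M}

theorem one_le_chartNorm (r : ℝ) (a : {i // ¬ P i} → ℝ) : 1 ≤ chartNorm M r a :=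
  Real.one_le_sqrt.2 (le_add_of_nonneg_right (Finset.sum_nonneg fun _ _ => sq_nonneg _))

theorem chartNorm_pos (r : ℝ) (a : {i // ¬ P i} → ℝ) : 0 < chartNorm M r a :=
  one_pos.trans_le (one_le_chartNorm r a)

theorem chartNorm_sq (r : ℝ) (a : {i // ¬ P i} → ℝ) :
    chartNorm M r a ^ 2 = 1 + ∑ i, (scale M r i / r * a i) ^ 2 :=
  Real.sq_sqrt (add_nonneg zero_le_one (Finset.sum_nonneg fun _ _ => sq_nonneg _))

theorem norm_join_eq_chartNorm {θ : EuclideanSpace ℝ {i // P i}} (hθ : ‖θ‖ = 1) (r : ℝ)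
    (a : {i // ¬ P i} → ℝ) : ‖join θ (fun i => scale M r i / r * a i)‖ = chartNorm M r a := by
  rw [chartNorm, ← one_pow (M := ℝ) 2, ← hθ, ← norm_sq_join, Real.sqrt_sq (norm_nonneg _)]

theorem chart_apply_pos {θ : EuclideanSpace ℝ {i // P i}} (hθ : ‖θ‖ = 1) (r : ℝ)
    (a : {i // ¬ P i} → ℝ) (i : {i // P i}) :
    chart M r θ a i = r * (θ i / chartNorm M r a) := by
  simp only [chart, gnomonic, norm_join_eq_chartNorm hθ, PiLp.smul_apply, smul_eq_mul,
    join_apply_of_pos _ _ i.2]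
  ring

theorem chart_apply_neg {θ : EuclideanSpace ℝ {i // P i}} (hθ : ‖θ‖ = 1) {r : ℝ} (hr : 0 < r)
    (a : {i // ¬ P i} → ℝ) (i : {i // ¬ P i}) :
    chart M r θ a i = scale M r i * (a i / chartNorm M r a) := by
  simp only [chart, gnomonic, norm_join_eq_chartNorm hθ, PiLp.smul_apply, smul_eq_mul,
    join_apply_of_neg _ _ i.2]
  field_simp

theorem norm_chart {θ : EuclideanSpace ℝ {i // P i}} (hθ : ‖θ‖ = 1) {r : ℝ} (hr : 0 < r)
    (a : {i // ¬ P i} → ℝ) : ‖chart M r θ a‖ = r := by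
  have h : 0 < ‖join θ fun i => scale M r i / r * a i‖ := norm_join_pos (by
    rintro rfl
    simp at hθ) _
  rw [chart, gnomonic, norm_smul, norm_smul, norm_inv, norm_norm, inv_mul_cancel₀ h.ne', mul_one,
    Real.norm_eq_abs, abs_of_pos hr]

theorem chartNorm_tendsto (a : {i // ¬ P i} → ℝ) :
    Tendsto (fun r => chartNorm M r a) atTop (𝓝 1) := by
  have h : Tendsto (fun r => 1 + ∑ i, (scale M r i / r * a i) ^ 2) atTop
      (𝓝 (1 + ∑ i : {i // ¬ P i}, (0 * a i) ^ 2)) :=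
    tendsto_const_nhds.add (tendsto_finsetSum _ fun i _ =>
      ((scale_div_tendsto i).mul_const _).pow 2)
  simpa [chartNorm] using h.sqrt

/-- With `ρ = chartNorm M r a`, write `ρ⁻¹ - 1 = -(ρ ^ 2 - 1) / (ρ * (ρ + 1))`, where `r * (ρ ^ 2 -
1)` is an explicit sum of squares. -/
theorem mul_inv_chartNorm_sub_one_tendsto (a : {i // ¬ P i} → ℝ) :
    Tendsto (fun r => r * ((chartNorm M r a)⁻¹ - 1)) atTop
      (𝓝 (-(1 / 2) * ∑ i, if M i then a i ^ 2 else 0)) := by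
  have h1 : Tendsto (fun r => ∑ i, r * (scale M r i / r) ^ 2 * a i ^ 2) atTop
      (𝓝 (∑ i, (if M i then 1 else 0) * a i ^ 2)) :=
    tendsto_finsetSum _ fun i _ => (mul_sq_scale_div_tendsto i).mul_const _
  have h2 : Tendsto (fun r => -((chartNorm M r a) * (chartNorm M r a + 1))⁻¹) atTop
      (𝓝 (-((1 : ℝ) * (1 + 1))⁻¹)) :=
    (((chartNorm_tendsto a).mul ((chartNorm_tendsto a).add_const 1)).inv₀ (by norm_num)).neg
  convert (h2.mul h1).congr fun r => ?_ using 2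
  · norm_num
  · have hp := chartNorm_pos (M := M) r a
    have hs : ∑ i, r * (scale M r i / r) ^ 2 * a i ^ 2 = r * (chartNorm M r a ^ 2 - 1) := by
      rw [chartNorm_sq, add_sub_cancel_left, Finset.mul_sum]
      exact Finset.sum_congr rfl fun i _ => by ring
    rw [hs]
    field_simp
    ring

variable {γ : ℝ} {i₀ : {i // P i}} {κ ν : {i // ¬ P i} → ℝ}

theorem phase_chart {θ : EuclideanSpace ℝ {i // P i}} (hθ : ‖θ‖ = 1) {r : ℝ} (hr : 0 < r)
    (a : {i // ¬ P i} → ℝ) :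
    phase M γ i₀ κ ν (chart M r θ a) - γ * r =
      γ * (r * (θ i₀ / chartNorm M r a - 1)) +
        ∑ i, if M i then 0 else
          (-κ i * (a i / chartNorm M r a) ^ 2 + ν i * (a i / chartNorm M r a)) := by
  have h : ∀ i, (if M i then 0 else
        (-κ i * chart M r θ a i ^ 2 + ν i * chart M r θ a i)) =
      if M i then 0 else
          (-κ i * (a i / chartNorm M r a) ^ 2 + ν i * (a i / chartNorm M r a)) := by
    intro i
    by_cases hi : M i
    · simp [hi]
    · simp [hi, chart_apply_neg hθ hr, scale]
  rw [phase, chart_apply_pos hθ, Finset.sum_congr rfl fun i _ => h i]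
  ring

/-- The phase has no quadratic term in the directions `M`; their decay comes from `γ * r * (θ i₀ / ρ
- 1)`. As `κ = γ / 2` and `ν = 0` there, the bound is one Gaussian exponent in `a / ρ`, uniform in
`r`. -/
theorem phase_chart_le (hγ : 0 ≤ γ) (hM : ∀ i, M i → κ i = γ / 2 ∧ ν i = 0)
    {θ : EuclideanSpace ℝ {i // P i}} (hθ : ‖θ‖ = 1) {r : ℝ} (hr : 0 < r)
    (a : {i // ¬ P i} → ℝ) :
    phase M γ i₀ κ ν (chart M r θ a) - γ * r ≤
      ∑ i, (-κ i * (a i / chartNorm M r a) ^ 2 + ν i * (a i / chartNorm M r a)) := by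
  rw [phase_chart hθ hr]
  set ρ := chartNorm M r a
  have hρ : 0 < ρ := chartNorm_pos r a
  have hθ1 : θ i₀ ≤ 1 := by
    have := PiLp.norm_apply_le θ i₀
    rw [hθ] at this
    exact (le_abs_self _).trans this
  have h1 : θ i₀ / ρ - 1 ≤ -((ρ ^ 2 - 1) / (2 * ρ ^ 2)) := by
    have h2 := one_sub_inv_ge (one_le_chartNorm (M := M) r a)
    have h3 : θ i₀ / ρ ≤ ρ⁻¹ := by
      rw [← one_div]
      gcongr
    linarith
  have h4 : γ * (r * (θ i₀ / ρ - 1)) ≤ ∑ i, if M i then -(γ / 2) * (a i / ρ) ^ 2 else 0 := by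
    calc γ * (r * (θ i₀ / ρ - 1)) ≤ γ * (r * -((ρ ^ 2 - 1) / (2 * ρ ^ 2))) := by gcongr
      _ = ∑ i, -(γ / 2) * (r * (scale M r i / r) ^ 2) * (a i / ρ) ^ 2 := by
        simp only [ρ, chartNorm_sq r a, add_sub_cancel_left]
        rw [← chartNorm_sq r a, Finset.sum_div, ← Finset.sum_neg_distrib, Finset.mul_sum,
          Finset.mul_sum]
        exact Finset.sum_congr rfl fun i _ => by field_simp
      _ ≤ _ := by
        refine Finset.sum_le_sum fun i _ => ?_
        split_ifs with hi
        · have : r * (scale M r i / r) ^ 2 = 1 := by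
            rw [scale, if_pos hi, div_pow, Real.sq_sqrt hr.le]
            field_simp
          rw [this, mul_one]
        -- Outside `M` the contribution is nonpositive and is dropped.
        · have : 0 ≤ γ / 2 * (r * (scale M r i / r) ^ 2) * (a i / ρ) ^ 2 := by positivity
          linarith
  refine (add_le_add_left h4 _).trans (le_of_eq ?_)
  rw [← Finset.sum_add_distrib]
  refine Finset.sum_congr rfl fun i _ => ?_
  split_ifs with hi
  · rw [(hM i hi).1, (hM i hi).2]
    ring
  · ring

/-- The limiting density: a Gaussian in `a`, concentrated at `θ i₀ = 1` unless `γ = 0`. -/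
theorem exp_phase_chart_tendsto (hγ : 0 ≤ γ) (hκ : ∀ i, 0 < κ i)
    (hM : ∀ i, M i → κ i = γ / 2 ∧ ν i = 0)
    {θ : EuclideanSpace ℝ {i // P i}} (hθ : ‖θ‖ = 1) (a : {i // ¬ P i} → ℝ) :
    Tendsto (fun r => Real.exp (phase M γ i₀ κ ν (chart M r θ a) - γ * r)) atTop
      (𝓝 ((if γ = 0 ∨ θ i₀ = 1 then 1 else 0) *
        Real.exp (∑ i, (-κ i * a i ^ 2 + ν i * a i)))) := by
  have hb : ∀ i, Tendsto (fun r => a i / chartNorm M r a) atTop (𝓝 (a i)) := fun i => by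
    have h : Tendsto (fun r => a i / chartNorm M r a) atTop (𝓝 (a i / 1)) :=
      tendsto_const_nhds.div (chartNorm_tendsto a) one_ne_zero
    simpa using h
  have hsum : Tendsto (fun r => ∑ i, if M i then 0 else
      (-κ i * (a i / chartNorm M r a) ^ 2 + ν i * (a i / chartNorm M r a))) atTop
      (𝓝 (∑ i, if M i then 0 else (-κ i * a i ^ 2 + ν i * a i))) := by
    refine tendsto_finsetSum _ fun i _ => ?_
    split_ifs
    · exact tendsto_const_nhds
    · exact (((hb i).pow 2).const_mul _).add ((hb i).const_mul _)
  have hev : (fun r => Real.exp (phase M γ i₀ κ ν (chart M r θ a) - γ * r)) =ᶠ[atTop]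
      fun r => Real.exp (γ * (r * (θ i₀ / chartNorm M r a - 1)) +
        ∑ i, if M i then 0 else
          (-κ i * (a i / chartNorm M r a) ^ 2 + ν i * (a i / chartNorm M r a))) := by
    filter_upwards [eventually_gt_atTop 0] with r hr
    rw [phase_chart hθ hr]
  refine Tendsto.congr' hev.symm ?_
  rcases eq_or_lt_of_le hγ with h0 | hpos
  -- If `γ = 0`, a direction in `M` would have `κ = 0`.
  · have hnM : ∀ i, ¬ M i := fun i hi => by
      have := hκ i
      rw [(hM i hi).1, ← h0] at this
      simp at this
    simp only [← h0, zero_mul, zero_add, hnM, if_false] at hsum ⊢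
    simpa using hsum.rexp
  by_cases hθ1 : θ i₀ = 1
  · simp only [hθ1, or_true, if_true, one_mul, one_div]
    have h := ((mul_inv_chartNorm_sub_one_tendsto (M := M) a).const_mul γ).add hsum
    convert h.rexp using 3
    rw [Finset.mul_sum, Finset.mul_sum, ← Finset.sum_add_distrib]
    refine Finset.sum_congr rfl fun i _ => ?_
    split_ifs with hi
    · rw [(hM i hi).1, (hM i hi).2]
      ring
    · ring
  -- Away from `θ i₀ = 1` the exponent tends to `-∞`, linearly in `r`.
  · have hlt : θ i₀ < 1 := by
      refine lt_of_le_of_ne ?_ hθ1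
      have := PiLp.norm_apply_le θ i₀
      rw [hθ] at this
      exact (le_abs_self _).trans this
    simp only [hpos.ne', hθ1, or_self, if_false, zero_mul]
    refine Real.tendsto_exp_atBot.comp (Tendsto.atBot_add ?_ hsum)
    refine Tendsto.const_mul_atBot hpos ?_
    have h1 : Tendsto (fun r => θ i₀ / chartNorm M r a - 1) atTop (𝓝 (θ i₀ / 1 - 1)) :=
      (tendsto_const_nhds.div (chartNorm_tendsto a) one_ne_zero).sub_const 1
    exact tendsto_id.atTop_mul_neg (by simpa using hlt) h1

/-- Laplace asymptotics of integrals over the sphere of radius `r`. -/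
theorem tendsto_integral_exp_phase (hγ : 0 ≤ γ) (hκ : ∀ i, 0 < κ i)
    (hM : ∀ i, M i → κ i = γ / 2 ∧ ν i = 0)
    {g : ℝ → EuclideanSpace ℝ ι → ℝ} (hg : ∀ r, Continuous (g r)) {C : ℝ}
    (hgC : ∀ r, 1 ≤ r → ∀ t : EuclideanSpace ℝ ι, ‖t‖ = r →
      |g r t| ≤ C * (1 + ∑ i : {i // ¬ P i}, (t i / scale M r i) ^ 2))
    {gθ : EuclideanSpace ℝ {i // P i} → ℝ} {ga : ({i // ¬ P i} → ℝ) → ℝ}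
    (hglim : ∀ θ : EuclideanSpace ℝ {i // P i}, ‖θ‖ = 1 → ∀ a,
      Tendsto (fun r => g r (chart M r θ a)) atTop (𝓝 (gθ θ * ga a))) :
    Tendsto (fun r => (∏ i, scale M r i / r)⁻¹ * Real.exp (-(γ * r)) *
        ∫ ω, g r (r • (ω : EuclideanSpace ℝ ι)) *
          Real.exp (phase M γ i₀ κ ν (r • (ω : EuclideanSpace ℝ ι)))
          ∂(volume : Measure (EuclideanSpace ℝ ι)).toSphere) atTop
      (𝓝 ((∫ θ, (if γ = 0 ∨ (θ : EuclideanSpace ℝ {i // P i}) i₀ = 1 then 1 else 0) *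
          gθ θ ∂(volume : Measure (EuclideanSpace ℝ {i // P i})).toSphere) *
        ∫ a, ga a * Real.exp (∑ i, (-κ i * a i ^ 2 + ν i * a i)))) := by
  have hne : Nonempty {i // P i} := ⟨i₀⟩
  set N := Fintype.card ι
  set σ := (volume : Measure (EuclideanSpace ℝ {i // P i})).toSphere
  obtain ⟨c, hc, hcκ⟩ := exists_pos_le hκ
  have hphase : Continuous (phase M γ i₀ κ ν) := by
    unfold phase
    refine Continuous.add (by fun_prop) (continuous_finsetSum _ fun i _ => ?_)
    split_ifs <;> fun_prop
  have hjoin : ∀ r, Continuous fun p : sphere (0 : EuclideanSpace ℝ {i // P i}) 1 ×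
      ({i // ¬ P i} → ℝ) =>
        join (p.1 : EuclideanSpace ℝ {i // P i}) fun i => scale M r i / r * p.2 i := fun r =>
    continuous_join.comp (by fun_prop : Continuous fun p :
      sphere (0 : EuclideanSpace ℝ {i // P i}) 1 × ({i // ¬ P i} → ℝ) =>
        ((p.1 : EuclideanSpace ℝ {i // P i}), fun i => scale M r i / r * p.2 i))
  let K : ℝ → sphere (0 : EuclideanSpace ℝ {i // P i}) 1 × ({i // ¬ P i} → ℝ) → ℝ := fun r p =>
    (chartNorm M r p.2)⁻¹ ^ N * (g r (chart M r p.1 p.2) *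
      Real.exp (phase M γ i₀ κ ν (chart M r p.1 p.2) - γ * r))
  have hsph : ∀ θ : sphere (0 : EuclideanSpace ℝ {i // P i}) 1,
      ‖(θ : EuclideanSpace ℝ {i // P i})‖ = 1 := fun θ => by simp
  have hK : ∀ r, 0 < r → (∏ i, scale M r i / r)⁻¹ * Real.exp (-(γ * r)) *
        ∫ ω, g r (r • (ω : EuclideanSpace ℝ ι)) *
          Real.exp (phase M γ i₀ κ ν (r • (ω : EuclideanSpace ℝ ι)))
          ∂(volume : Measure (EuclideanSpace ℝ ι)).toSphere = ∫ p, K r p ∂(σ.prod volume) := by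
    intro r hr
    have hD : ∀ i, 0 < scale M r i / r := fun i => div_pos (scale_pos hr i) hr
    have hprod : 0 < ∏ i, scale M r i / r := Finset.prod_pos fun i _ => hD i
    have hcont : Continuous fun t : EuclideanSpace ℝ ι =>
        g r (r • t) * Real.exp (phase M γ i₀ κ ν (r • t)) :=
      ((hg r).comp (by fun_prop)).mul (Real.continuous_exp.comp (hphase.comp (by fun_prop)))
    rw [integral_toSphere_gnomonic (P := P) hcont.measurable hD, mul_mul_mul_comm,
      inv_mul_cancel₀ hprod.ne', one_mul, ← integral_const_mul]
    refine integral_congr_ae (.of_forall fun p => ?_)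
    simp only [K]
    rw [norm_join_eq_chartNorm (hsph p.1), sub_eq_add_neg, Real.exp_add]
    simp only [chart]
    ring
  -- The Gaussian factor controls `v`, and the Jacobian supplies the decay for large `a`.
  obtain ⟨B, hB⟩ : ∃ B : ℝ, ∀ r, 1 ≤ r → ∀ p, ‖K r p‖ ≤ B * (1 + ‖p.2‖ ^ 2) ^ (-(N : ℝ) / 2) := by
    set T := ∑ i, ν i ^ 2 / (2 * c)
    -- One of the `N + 1` powers of `1 + v` pays for the growth of `g`, the other `N` are traded
    -- against the Jacobian in `hdecay`.
    set A := (N + 1).factorial * Real.exp (c / 2) / (c / 2) ^ (N + 1)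
    refine ⟨|C| * (A * Real.exp T), fun r hr p => ?_⟩
    have hr0 : 0 < r := one_pos.trans_le hr
    set ρ := chartNorm M r p.2 with hρdef
    have hρ : 0 < ρ := chartNorm_pos r p.2
    set v := ∑ i, (p.2 i / ρ) ^ 2 with hv
    have hv0 : 0 ≤ v := Finset.sum_nonneg fun _ _ => sq_nonneg _
    have hgb : |g r (chart M r p.1 p.2)| ≤ |C| * (1 + v) := by
      refine (hgC r hr _ (norm_chart (hsph p.1) hr0 p.2)).trans ?_
      have : ∑ i : {i // ¬ P i}, (chart M r (p.1 : EuclideanSpace ℝ {i // P i}) p.2 i /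
          scale M r i) ^ 2 = v := by
        refine Finset.sum_congr rfl fun i _ => ?_
        rw [chart_apply_neg (hsph p.1) hr0, mul_div_cancel_left₀ _ (scale_pos hr0 i).ne']
      rw [this]
      gcongr
      exact le_abs_self C
    have hexp : Real.exp (phase M γ i₀ κ ν (chart M r p.1 p.2) - γ * r) ≤
        Real.exp (-(c / 2 * v)) * Real.exp T := by
      rw [← Real.exp_add]
      exact Real.exp_le_exp.2 ((phase_chart_le hγ hM (hsph p.1) hr0 p.2).trans
        (sum_quadratic_le hc hcκ ν _))
    have hpow := one_add_pow_mul_exp_neg_le (half_pos hc) hv0 (N + 1)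
    have hS : 1 + ‖p.2‖ ^ 2 ≤ ρ ^ 2 * (1 + v) := by
      have h1 : ‖p.2‖ ^ 2 ≤ ∑ i, p.2 i ^ 2 := by
        have := EuclideanSpace.real_norm_sq_eq (WithLp.toLp 2 p.2)
        simp only at this
        rw [← this]
        have := PiLp.lipschitzWith_ofLp 2 (fun _ : {i // ¬ P i} => ℝ)
        have := this.norm_le_mul (f := WithLp.ofLp) rfl (WithLp.toLp 2 p.2)
        simp only [NNReal.coe_one, one_mul] at this
        gcongr
      have h2 : ρ ^ 2 * v = ∑ i, p.2 i ^ 2 := by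
        rw [hv, Finset.mul_sum]
        exact Finset.sum_congr rfl fun i _ => by field_simp
      have h3 : 1 ≤ ρ ^ 2 := one_le_pow₀ (one_le_chartNorm r p.2)
      rw [mul_add, h2, mul_one]
      linarith
    have hdecay := inv_mul_pow_le_rpow hρ hv0 (sq_nonneg ‖p.2‖) hS N
    have hK' : ‖K r p‖ = ρ⁻¹ ^ N * (|g r (chart M r p.1 p.2)| *
        Real.exp (phase M γ i₀ κ ν (chart M r p.1 p.2) - γ * r)) := by
      simp only [K, norm_mul, Real.norm_eq_abs, Real.abs_exp]
      rw [abs_of_pos (by positivity)]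
    rw [hK']
    calc ρ⁻¹ ^ N * (|g r (chart M r p.1 p.2)| *
        Real.exp (phase M γ i₀ κ ν (chart M r p.1 p.2) - γ * r))
        ≤ ρ⁻¹ ^ N * ((|C| * (1 + v)) * (Real.exp (-(c / 2 * v)) * Real.exp T)) := by gcongr
      _ = |C| * ((1 + v) ^ (N + 1) * Real.exp (-(c / 2 * v)) * Real.exp T) *
          (ρ⁻¹ ^ N * ((1 + v) ^ N)⁻¹) := by
        have : (1 + v) ^ N ≠ 0 := by positivity
        rw [pow_succ]
        field_simp
      _ ≤ |C| * (A * Real.exp T) * (1 + ‖p.2‖ ^ 2) ^ (-(N : ℝ) / 2) := by gcongr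
  have hint : Integrable (fun p : sphere (0 : EuclideanSpace ℝ {i // P i}) 1 ×
      ({i // ¬ P i} → ℝ) => B * (1 + ‖p.2‖ ^ 2) ^ (-(N : ℝ) / 2)) (σ.prod volume) := by
    -- The bound is integrable because `i₀` satisfies `P`, so `a` has fewer than `N` coordinates.
    have hlt : (Module.finrank ℝ ({i // ¬ P i} → ℝ) : ℝ) < N := by
      rw [Module.finrank_fintype_fun_eq_card]
      exact_mod_cast Fintype.card_subtype_lt (x := (i₀ : ι)) (by simpa using i₀.2)
    exact ((integrable_rpow_neg_one_add_norm_sq hlt).comp_snd σ).const_mul B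
  have hlim := tendsto_integral_filter_of_dominated_convergence (μ := σ.prod volume)
    (F := K) (l := atTop) (f := fun p => ((if γ = 0 ∨ (p.1 : EuclideanSpace ℝ {i // P i}) i₀ = 1
        then 1 else 0) * gθ p.1) * (ga p.2 * Real.exp (∑ i, (-κ i * p.2 i ^ 2 + ν i * p.2 i))))
    _ ?_ ?_ hint ?_
  · rw [integral_prod_mul (fun θ : sphere (0 : EuclideanSpace ℝ {i // P i}) 1 =>
      (if γ = 0 ∨ (θ : EuclideanSpace ℝ {i // P i}) i₀ = 1 then 1 else 0) * gθ θ)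
      (fun a => ga a * Real.exp (∑ i, (-κ i * a i ^ 2 + ν i * a i)))] at hlim
    refine hlim.congr' ?_
    filter_upwards [eventually_gt_atTop 0] with r hr
    exact (hK r hr).symm
  · filter_upwards [eventually_gt_atTop 0] with r hr
    have hρ : Continuous fun p : sphere (0 : EuclideanSpace ℝ {i // P i}) 1 ×
      ({i // ¬ P i} → ℝ) => chartNorm M r p.2 := by
      unfold chartNorm
      fun_prop
    have hch : Continuous fun p : sphere (0 : EuclideanSpace ℝ {i // P i}) 1 ×
      ({i // ¬ P i} → ℝ) => chart M r (p.1 : EuclideanSpace ℝ {i // P i}) p.2 := by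
      unfold chart gnomonic
      simp_rw [fun p : sphere (0 : EuclideanSpace ℝ {i // P i}) 1 × ({i // ¬ P i} → ℝ) =>
        norm_join_eq_chartNorm (M := M) (hsph p.1) r p.2]
      exact Continuous.const_smul ((hρ.inv₀ fun p => (chartNorm_pos r p.2).ne').smul (hjoin r)) r
    refine Continuous.aestronglyMeasurable ?_
    exact ((hρ.inv₀ fun p => (chartNorm_pos r p.2).ne').pow N).mul (((hg r).comp hch).mul
      (Real.continuous_exp.comp ((hphase.comp hch).sub continuous_const)))
  · filter_upwards [eventually_ge_atTop 1] with r hr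
    exact .of_forall (hB r hr)
  · refine .of_forall fun p => ?_
    have h1 : Tendsto (fun r => (chartNorm M r p.2)⁻¹ ^ N) atTop (𝓝 ((1 : ℝ)⁻¹ ^ N)) :=
      ((chartNorm_tendsto p.2).inv₀ one_ne_zero).pow N
    convert h1.mul ((hglim p.1 (hsph p.1) p.2).mul
      (exp_phase_chart_tendsto (i₀ := i₀) hγ hκ hM (hsph p.1) p.2)) using 2
    simp only [inv_one, one_pow]
    ring

end Chart

/-! ### Partial derivatives as moments. -/

section Moments

variable {d : ℕ}

/-- The exponent of the Fisher-Bingham density. -/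
def exponent (lam tau : Fin d → ℝ) (t : EuclideanSpace ℝ (Fin d)) : ℝ :=
  ∑ i, lam i * t i ^ 2 + ∑ i, tau i * t i

/-- The integral of `g` against the Fisher-Bingham density on the sphere of radius `r`. -/
def moment (lam tau : Fin d → ℝ) (g : EuclideanSpace ℝ (Fin d) → ℝ) (r : ℝ) : ℝ :=
  ∫ t, g t * Real.exp (exponent lam tau t) ∂(sphereVolume d r)

@[fun_prop]
theorem continuous_exponent (lam tau : Fin d → ℝ) : Continuous (exponent lam tau) := by
  unfold exponent
  fun_prop

theorem integral_eq_moment (lam tau : Fin d → ℝ) (r : ℝ) :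
    integral lam tau r = moment lam tau (fun _ => 1) r := by
  simp [integral, moment, exponent]

theorem moment_eq (lam tau : Fin d → ℝ) {g : EuclideanSpace ℝ (Fin d) → ℝ} (hg : Continuous g)
    {r : ℝ} (hr : 0 < r) :
    moment lam tau g r = r ^ (d - 1) * ∫ ω, g (r • (ω : EuclideanSpace ℝ (Fin d))) *
      Real.exp (exponent lam tau (r • (ω : EuclideanSpace ℝ (Fin d))))
        ∂(volume : Measure (EuclideanSpace ℝ (Fin d))).toSphere :=
  integral_sphereVolume hr (by fun_prop)

theorem moment_const_mul (lam tau : Fin d → ℝ) (g : EuclideanSpace ℝ (Fin d) → ℝ) (c r : ℝ) :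
    moment lam tau (fun t => c * g t) r = c * moment lam tau g r := by
  simp only [moment, mul_assoc]
  exact integral_const_mul _ _

/-- Differentiation under the integral sign over a sphere. -/
theorem hasDerivAt_integral_exp {h k : EuclideanSpace ℝ (Fin d) → ℝ} (hh : Continuous h)
    (hk : Continuous k) {r : ℝ} (hr : 0 < r) (s₀ : ℝ) :
    HasDerivAt (fun s => ∫ t, Real.exp (h t + s * k t) ∂(sphereVolume d r))
      (∫ t, k t * Real.exp (h t + s₀ * k t) ∂(sphereVolume d r)) s₀ := by
  have e : ∀ s, ∫ t, Real.exp (h t + s * k t) ∂(sphereVolume d r) = r ^ (d - 1) *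
      ∫ ω, Real.exp (h (r • (ω : EuclideanSpace ℝ (Fin d))) +
        s * k (r • (ω : EuclideanSpace ℝ (Fin d))))
        ∂(volume : Measure (EuclideanSpace ℝ (Fin d))).toSphere := fun s =>
    integral_sphereVolume hr (by fun_prop)
  simp_rw [e]
  rw [integral_sphereVolume hr (by fun_prop)]
  refine HasDerivAt.const_mul _ ?_
  obtain ⟨A, hA⟩ := (isCompact_sphere (0 : EuclideanSpace ℝ (Fin d)) r).exists_bound_of_continuousOn
    hh.continuousOn
  obtain ⟨B, hB⟩ := (isCompact_sphere (0 : EuclideanSpace ℝ (Fin d)) r).exists_bound_of_continuousOn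
    hk.continuousOn
  have hmem : ∀ ω : sphere (0 : EuclideanSpace ℝ (Fin d)) 1,
      r • (ω : EuclideanSpace ℝ (Fin d)) ∈ sphere (0 : EuclideanSpace ℝ (Fin d)) r := fun ω => by
    simp [norm_smul, abs_of_pos hr]
  refine (hasDerivAt_integral_of_dominated_loc_of_deriv_le (s := ball s₀ 1)
    (μ := (volume : Measure (EuclideanSpace ℝ (Fin d))).toSphere)
    (F := fun s ω => Real.exp (h (r • (ω : EuclideanSpace ℝ (Fin d))) +
      s * k (r • (ω : EuclideanSpace ℝ (Fin d)))))
    (F' := fun s ω => k (r • (ω : EuclideanSpace ℝ (Fin d))) *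
      Real.exp (h (r • (ω : EuclideanSpace ℝ (Fin d))) +
        s * k (r • (ω : EuclideanSpace ℝ (Fin d)))))
    (bound := fun _ => B * Real.exp (A + (|s₀| + 1) * B)) (ball_mem_nhds _ one_pos)
    (.of_forall fun s => ?_)
    (integrable_toSphere_of_continuous (φ := fun t => Real.exp (h (r • t) + s₀ * k (r • t)))
      (by fun_prop)) ?_ (.of_forall fun ω s hs => ?_) (integrable_const _)
      (.of_forall fun ω s _ => ?_)).2
  · exact Continuous.aestronglyMeasurable (by fun_prop)
  · exact Continuous.aestronglyMeasurable (by fun_prop)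
  · have h1 := hA _ (hmem ω)
    have h2 := hB _ (hmem ω)
    rw [Real.norm_eq_abs] at h1 h2
    have hs' : |s| ≤ |s₀| + 1 := by
      have h3 : |s - s₀| < 1 := by simpa [Real.dist_eq] using hs
      have h4 := abs_add_le (s - s₀) s₀
      rw [sub_add_cancel] at h4
      linarith
    have hB0 : 0 ≤ B := (abs_nonneg _).trans h2
    rw [norm_mul, Real.norm_eq_abs, Real.norm_eq_abs, Real.abs_exp]
    refine mul_le_mul h2 (Real.exp_le_exp.2 (add_le_add ((le_abs_self _).trans h1) ?_))
      (Real.exp_pos _).le hB0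
    refine (le_abs_self _).trans ?_
    rw [abs_mul]
    gcongr
  · have h1 : HasDerivAt (fun s => h (r • (ω : EuclideanSpace ℝ (Fin d))) +
        s * k (r • (ω : EuclideanSpace ℝ (Fin d)))) (k (r • (ω : EuclideanSpace ℝ (Fin d)))) s := by
      simpa using ((hasDerivAt_id s).mul_const (k (r • (ω : EuclideanSpace ℝ (Fin d))))).const_add
        (h (r • (ω : EuclideanSpace ℝ (Fin d))))
    rw [mul_comm]
    exact h1.exp

theorem sum_update_mul (lam u : Fin d → ℝ) (j : Fin d) (s : ℝ) :
    ∑ i, Function.update lam j s i * u i = ∑ i, lam i * u i - lam j * u j + s * u j := by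
  have h : ∀ i, Function.update lam j s i * u i =
      lam i * u i + if i = j then (s - lam j) * u j else 0 := by
    intro i
    by_cases hi : i = j
    · subst hi
      simp
      ring
    · simp [hi]
  simp_rw [h, Finset.sum_add_distrib, Finset.sum_ite_eq' Finset.univ j]
  simp
  ring

/-- The exponent is affine in each parameter; its slope in `lam j` is `t j ^ 2`. -/
theorem hasDerivAt_integral_lam (lam tau : Fin d → ℝ) (j : Fin d) {r : ℝ} (hr : 0 < r) :
    HasDerivAt (fun s => integral (Function.update lam j s) tau r)
      (moment lam tau (fun t => t j ^ 2) r) (lam j) := by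
  have h := hasDerivAt_integral_exp (h := fun t => exponent lam tau t - lam j * t j ^ 2)
    (k := fun t => t j ^ 2) (by fun_prop) (by fun_prop) hr (lam j)
  convert h using 1
  · ext s
    refine integral_congr_ae (.of_forall fun t => ?_)
    simp only [exponent, sum_update_mul lam (fun i => t i ^ 2)]
    congr 1
    ring
  · simp [moment]

theorem hasDerivAt_integral_tau (lam tau : Fin d → ℝ) (j : Fin d) {r : ℝ} (hr : 0 < r) :
    HasDerivAt (fun s => integral lam (Function.update tau j s) r)
      (moment lam tau (fun t => t j) r) (tau j) := by
  have h := hasDerivAt_integral_exp (h := fun t => exponent lam tau t - tau j * t j)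
    (k := fun t => t j) (by fun_prop) (by fun_prop) hr (tau j)
  convert h using 1
  · ext s
    refine integral_congr_ae (.of_forall fun t => ?_)
    simp only [exponent, sum_update_mul tau (fun i => t i)]
    congr 1
    ring
  · simp [moment]

theorem derivLam_eq_moment (lam tau : Fin d → ℝ) (j : Fin d) {r : ℝ} (hr : 0 < r) :
    derivLam lam tau j r = moment lam tau (fun t => t j ^ 2) r :=
  (hasDerivAt_integral_lam lam tau j hr).deriv

theorem derivTau_eq_moment (lam tau : Fin d → ℝ) (j : Fin d) {r : ℝ} (hr : 0 < r) :
    derivTau lam tau j r = moment lam tau (fun t => t j) r :=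
  (hasDerivAt_integral_tau lam tau j hr).deriv

/-- If `τ_j = 0`, the density is invariant under `t_j ↦ -t_j`. -/
theorem derivTau_eq_zero (lam tau : Fin d → ℝ) {j : Fin d} (hj : tau j = 0) {r : ℝ} (hr : 0 < r) :
    derivTau lam tau j r = 0 := by
  have : Nonempty (Fin d) := ⟨j⟩
  let R : EuclideanSpace ℝ (Fin d) ≃ₗᵢ[ℝ] EuclideanSpace ℝ (Fin d) :=
    LinearIsometryEquiv.piLpCongrRight 2 fun i =>
      if i = j then LinearIsometryEquiv.neg ℝ else LinearIsometryEquiv.refl ℝ ℝ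
  have hRj : ∀ t, R t j = -t j := fun t => by simp [R]
  have hRi : ∀ t i, i ≠ j → R t i = t i := fun t i hi => by simp [R, hi]
  have hexp : ∀ t, exponent lam tau (R t) = exponent lam tau t := by
    intro t
    unfold exponent
    congr 1 <;> refine Finset.sum_congr rfl fun i _ => ?_
    · by_cases hi : i = j
      · rw [hi, hRj, neg_sq]
      · rw [hRi t i hi]
    · by_cases hi : i = j
      · rw [hi, hj, zero_mul, zero_mul]
      · rw [hRi t i hi]
  rw [derivTau_eq_moment lam tau j hr, moment_eq lam tau (by fun_prop) hr]
  have h := integral_toSphere_isometry R (φ := fun t =>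
    (r • t) j * Real.exp (exponent lam tau (r • t))) (by fun_prop)
  simp only [← map_smul, hexp, hRj, neg_mul, integral_neg] at h
  rw [mul_eq_zero]
  right
  linarith

end Moments

/-! ### From normalised limits to asymptotic equivalence. -/

section Equivalence

/-- `w` normalises the integral and `k` is the power of `r` extracted from the moment. The limit
must be nonzero: equivalence to `0` would mean eventual equality with `0`. -/
theorem isEquivalent_of_tendsto_mul {w f h k D : ℝ → ℝ} {l c : ℝ} (hw : ∀ᶠ r in atTop, w r ≠ 0)
    (hf : Tendsto (fun r => w r * f r) atTop (𝓝 l))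
    (hh : Tendsto (fun r => w r * h r) atTop (𝓝 (c * l))) (hl : l ≠ 0) (hc : c ≠ 0)
    (hD : ∀ᶠ r in atTop, D r = k r * h r) :
    D ~[atTop] fun r => k r * c * f r := by
  have h1 : (fun r => w r * h r) ~[atTop] fun r => w r * (c * f r) := by
    refine ((isEquivalent_const_iff_tendsto (mul_ne_zero hc hl)).2 hh).trans
      ((isEquivalent_const_iff_tendsto (mul_ne_zero hc hl)).2 ?_).symm
    simpa only [mul_left_comm] using hf.const_mul c
  have h2 := (IsEquivalent.refl (u := fun r => k r * (w r)⁻¹) (l := atTop)).mul h1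
  refine (h2.congr_left ?_).congr_right ?_
  · filter_upwards [hw, hD] with r hr hDr
    simp only [Pi.mul_apply]
    rw [hDr]
    field_simp
  · filter_upwards [hw] with r hr
    simp only [Pi.mul_apply]
    field_simp

theorem isEquivalent_of_tendsto_inv {w f v : ℝ → ℝ} {l : ℝ}
    (hf : Tendsto (fun r => w r * f r) atTop (𝓝 l)) (hl : l ≠ 0)
    (hv : ∀ᶠ r in atTop, w r * v r = l) (hw : ∀ᶠ r in atTop, w r ≠ 0) : f ~[atTop] v := by
  have hv' : Tendsto (fun r => w r * v r) atTop (𝓝 l) :=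
    tendsto_const_nhds.congr' (hv.mono fun r hr => hr.symm)
  have h := isEquivalent_of_tendsto_mul (c := 1) (k := fun _ => 1) hw hv' (by simpa using hf) hl
    one_ne_zero (.of_forall fun r => (one_mul (f r)).symm)
  simpa using h

end Equivalence

/-! ### Limits of the normalised moments. -/

section Laplace

variable {d : ℕ} {P : Fin d → Prop} [DecidablePred P] {M : {i // ¬ P i} → Prop} [DecidablePred M]
  {γ Λ : ℝ} {i₀ : {i // P i}} {κ ν : {i // ¬ P i} → ℝ} {lam tau : Fin d → ℝ}
  {L : EuclideanSpace ℝ (Fin d) ≃ₗᵢ[ℝ] EuclideanSpace ℝ (Fin d)}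

/-- The inverse of the growth rate of the moments. -/
def growthInv (M : {i // ¬ P i} → Prop) [DecidablePred M] (γ Λ r : ℝ) : ℝ :=
  (r ^ (d - 1) * ∏ i, scale M r i / r)⁻¹ * Real.exp (-(γ * r)) * Real.exp (-(Λ * r ^ 2))

theorem growthInv_ne_zero {r : ℝ} (hr : 0 < r) : growthInv M γ Λ r ≠ 0 := by
  have h : 0 < ∏ i, scale M r i / r :=
    Finset.prod_pos fun i _ => div_pos (scale_pos hr i) hr
  unfold growthInv
  positivity

/-- Invariance under `L` puts the exponent in adapted coordinates, where `Λ * ‖x‖ ^ 2` only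
contributes the factor `exp (Λ * r ^ 2)`. -/
theorem tendsto_moment (hγ : 0 ≤ γ) (hκ : ∀ i, 0 < κ i)
    (hM : ∀ i, M i → κ i = γ / 2 ∧ ν i = 0)
    (hL : ∀ x, exponent lam tau (L x) = Λ * ‖x‖ ^ 2 + phase M γ i₀ κ ν x)
    {g : ℝ → EuclideanSpace ℝ (Fin d) → ℝ} (hg : ∀ r, Continuous (g r)) {C : ℝ}
    (hgC : ∀ r, 1 ≤ r → ∀ x : EuclideanSpace ℝ (Fin d), ‖x‖ = r →
      |g r (L x)| ≤ C * (1 + ∑ i : {i // ¬ P i}, (x i / scale M r i) ^ 2))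
    {gθ : EuclideanSpace ℝ {i // P i} → ℝ} {ga : ({i // ¬ P i} → ℝ) → ℝ}
    (hglim : ∀ θ : EuclideanSpace ℝ {i // P i}, ‖θ‖ = 1 → ∀ a,
      Tendsto (fun r => g r (L (chart M r θ a))) atTop (𝓝 (gθ θ * ga a))) :
    Tendsto (fun r => growthInv M γ Λ r * moment lam tau (g r) r) atTop
      (𝓝 ((∫ θ, (if γ = 0 ∨ (θ : EuclideanSpace ℝ {i // P i}) i₀ = 1 then 1 else 0) *
          gθ θ ∂(volume : Measure (EuclideanSpace ℝ {i // P i})).toSphere) *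
        ∫ a, ga a * Real.exp (∑ i, (-κ i * a i ^ 2 + ν i * a i)))) := by
  have : Nonempty (Fin d) := ⟨i₀⟩
  refine (tendsto_integral_exp_phase (i₀ := i₀) hγ hκ hM (g := fun r x => g r (L x))
    (fun r => (hg r).comp L.continuous) hgC hglim).congr' ?_
  filter_upwards [eventually_gt_atTop 0] with r hr
  have h := integral_toSphere_isometry L (φ := fun t =>
    g r (r • t) * Real.exp (exponent lam tau (r • t)))
    (((hg r).comp (by fun_prop : Continuous fun t : EuclideanSpace ℝ (Fin d) => r • t)).mul
      (by fun_prop)).measurable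
  rw [moment_eq lam tau (hg r) hr, ← h]
  have e : ∀ ω : sphere (0 : EuclideanSpace ℝ (Fin d)) 1,
      g r (r • L (ω : EuclideanSpace ℝ (Fin d))) *
        Real.exp (exponent lam tau (r • L (ω : EuclideanSpace ℝ (Fin d)))) =
      Real.exp (Λ * r ^ 2) * (g r (L (r • (ω : EuclideanSpace ℝ (Fin d)))) *
        Real.exp (phase M γ i₀ κ ν (r • (ω : EuclideanSpace ℝ (Fin d))))) := by
    intro ω
    have hn : ‖r • (ω : EuclideanSpace ℝ (Fin d))‖ = r := by simp [norm_smul, abs_of_pos hr]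
    rw [← map_smul, hL, hn, Real.exp_add]
    ring
  simp_rw [e]
  rw [integral_const_mul, growthInv, Real.exp_neg (Λ * r ^ 2), mul_inv]
  have hr' : r ^ (d - 1) ≠ 0 := by positivity
  field_simp

/-- The limiting mass of the angular variable. -/
def angularMass (γ : ℝ) (i₀ : {i // P i}) : ℝ :=
  ∫ θ, (if γ = 0 ∨ (θ : EuclideanSpace ℝ {i // P i}) i₀ = 1 then 1 else 0)
    ∂(volume : Measure (EuclideanSpace ℝ {i // P i})).toSphere

theorem tendsto_integral (hγ : 0 ≤ γ) (hκ : ∀ i, 0 < κ i)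
    (hM : ∀ i, M i → κ i = γ / 2 ∧ ν i = 0)
    (hL : ∀ x, exponent lam tau (L x) = Λ * ‖x‖ ^ 2 + phase M γ i₀ κ ν x) :
    Tendsto (fun r => growthInv M γ Λ r * integral lam tau r) atTop
      (𝓝 (angularMass γ i₀ * gaussMass κ ν)) := by
  have h := tendsto_moment hγ hκ hM hL (g := fun _ _ => 1) (C := 1) (gθ := fun _ => 1)
    (ga := fun _ => 1) (fun _ => continuous_const)
    (fun r _ x _ => by
      have : 0 ≤ ∑ i : {i // ¬ P i}, (x i / scale M r i) ^ 2 :=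
        Finset.sum_nonneg fun _ _ => sq_nonneg _
      rw [abs_one]
      linarith)
    (fun _ _ _ => by simp)
  simp only [mul_one, one_mul, integral_exp_sum_quadratic hκ] at h
  simpa only [integral_eq_moment, angularMass] using h

theorem chart_div_scale_tendsto {θ : EuclideanSpace ℝ {i // P i}} (hθ : ‖θ‖ = 1)
    (a : {i // ¬ P i} → ℝ) (j : {i // ¬ P i}) :
    Tendsto (fun r => chart M r θ a j / scale M r j) atTop (𝓝 (a j)) := by
  have h : Tendsto (fun r => a j / chartNorm M r a) atTop (𝓝 (a j / 1)) :=
    tendsto_const_nhds.div (chartNorm_tendsto a) one_ne_zero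
  rw [div_one] at h
  refine h.congr' ?_
  filter_upwards [eventually_gt_atTop 0] with r hr
  rw [chart_apply_neg hθ hr, mul_div_cancel_left₀ _ (scale_pos hr j).ne']

theorem tendsto_moment_coord (hγ : 0 ≤ γ) (hκ : ∀ i, 0 < κ i)
    (hM : ∀ i, M i → κ i = γ / 2 ∧ ν i = 0)
    (hL : ∀ x, exponent lam tau (L x) = Λ * ‖x‖ ^ 2 + phase M γ i₀ κ ν x) (j : {i // ¬ P i})
    (hj : ∀ x, L x j = x j) :
    Tendsto (fun r => growthInv M γ Λ r * moment lam tau (fun t => t j / scale M r j) r) atTop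
      (𝓝 (angularMass γ i₀ * (ν j / (2 * κ j) * gaussMass κ ν))) := by
  have h := tendsto_moment hγ hκ hM hL (g := fun r t => t j / scale M r j) (C := 1)
    (gθ := fun _ => 1) (ga := fun a => a j) (fun _ => by fun_prop)
    (fun r _ x _ => by
      have : (x j / scale M r j) ^ 2 ≤ ∑ i : {i // ¬ P i}, (x i / scale M r i) ^ 2 :=
        Finset.single_le_sum (f := fun i : {i // ¬ P i} => (x i / scale M r i) ^ 2)
          (fun _ _ => sq_nonneg _) (Finset.mem_univ j)
      rw [hj, one_mul, ← sq_abs (x j / scale M r j)] at *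
      nlinarith [sq_nonneg (|x j / scale M r j| - 1)])
    (fun θ hθ a => by simpa only [hj, one_mul] using chart_div_scale_tendsto hθ a j)
  simpa only [mul_one, angularMass, integral_eval_mul_exp_sum_quadratic hκ] using h

theorem tendsto_moment_coord_sq (hγ : 0 ≤ γ) (hκ : ∀ i, 0 < κ i)
    (hM : ∀ i, M i → κ i = γ / 2 ∧ ν i = 0)
    (hL : ∀ x, exponent lam tau (L x) = Λ * ‖x‖ ^ 2 + phase M γ i₀ κ ν x) (j : {i // ¬ P i})
    (hj : ∀ x, L x j = x j) :
    Tendsto (fun r => growthInv M γ Λ r * moment lam tau (fun t => (t j / scale M r j) ^ 2) r) atTop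
      (𝓝 (angularMass γ i₀ *
        ((1 / (2 * κ j) + ν j ^ 2 / (4 * κ j ^ 2)) * gaussMass κ ν))) := by
  have h := tendsto_moment hγ hκ hM hL (g := fun r t => (t j / scale M r j) ^ 2) (C := 1)
    (gθ := fun _ => 1) (ga := fun a => a j ^ 2) (fun _ => by fun_prop)
    (fun r _ x _ => by
      have : (x j / scale M r j) ^ 2 ≤ ∑ i : {i // ¬ P i}, (x i / scale M r i) ^ 2 :=
        Finset.single_le_sum (f := fun i : {i // ¬ P i} => (x i / scale M r i) ^ 2)
          (fun _ _ => sq_nonneg _) (Finset.mem_univ j)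
      rw [hj, one_mul, abs_of_nonneg (sq_nonneg _)]
      linarith)
    (fun θ hθ a => by simpa only [hj, one_mul] using (chart_div_scale_tendsto hθ a j).pow 2)
  simpa only [mul_one, angularMass, integral_eval_sq_mul_exp_sum_quadratic hκ] using h

theorem chart_div_tendsto {θ : EuclideanSpace ℝ {i // P i}} (hθ : ‖θ‖ = 1)
    (a : {i // ¬ P i} → ℝ) (i : Fin d) :
    Tendsto (fun r => chart M r θ a i / r) atTop (𝓝 (join θ 0 i)) := by
  by_cases hi : P i
  · rw [join_apply_of_pos _ _ hi]
    have h : Tendsto (fun r => θ ⟨i, hi⟩ / chartNorm M r a) atTop (𝓝 (θ ⟨i, hi⟩ / 1)) :=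
      tendsto_const_nhds.div (chartNorm_tendsto a) one_ne_zero
    rw [div_one] at h
    refine h.congr' ?_
    filter_upwards [eventually_gt_atTop 0] with r hr
    have := chart_apply_pos (M := M) hθ r a ⟨i, hi⟩
    simp only at this
    rw [this, mul_div_cancel_left₀ _ hr.ne']
  · rw [join_apply_of_neg _ _ hi]
    have h := (scale_div_tendsto (M := M) ⟨i, hi⟩).mul
      (chart_div_scale_tendsto (M := M) hθ a ⟨i, hi⟩)
    simp only [zero_mul] at h
    refine h.congr' ?_
    filter_upwards [eventually_gt_atTop 0] with r hr
    have := (scale_pos (M := M) hr ⟨i, hi⟩).ne'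
    field_simp

/-- On the scale `r` the coordinates outside `P` vanish in the limit, so only `θ` remains. The
vector `w` is the row `j` of the matrix of `L`. -/
theorem tendsto_moment_div_pow (hγ : 0 ≤ γ) (hκ : ∀ i, 0 < κ i)
    (hM : ∀ i, M i → κ i = γ / 2 ∧ ν i = 0)
    (hL : ∀ x, exponent lam tau (L x) = Λ * ‖x‖ ^ 2 + phase M γ i₀ κ ν x) (j : Fin d)
    {w : Fin d → ℝ} (hw : ∀ x, L x j = ∑ i, w i * x i) (n : ℕ) :
    Tendsto (fun r => growthInv M γ Λ r * moment lam tau (fun t => (t j / r) ^ n) r) atTop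
      (𝓝 ((∫ θ, (if γ = 0 ∨ (θ : EuclideanSpace ℝ {i // P i}) i₀ = 1 then 1 else 0) *
          (∑ i, w i * join (θ : EuclideanSpace ℝ {i // P i}) 0 i) ^ n
          ∂(volume : Measure (EuclideanSpace ℝ {i // P i})).toSphere) * gaussMass κ ν)) := by
  have h := tendsto_moment hγ hκ hM hL (g := fun r t => (t j / r) ^ n) (C := 1)
    (gθ := fun θ => (∑ i, w i * join θ 0 i) ^ n) (ga := fun _ => 1) (fun _ => by fun_prop)
    (fun r hr x hx => by
      have h0 : 0 ≤ ∑ i : {i // ¬ P i}, (x i / scale M r i) ^ 2 :=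
        Finset.sum_nonneg fun _ _ => sq_nonneg _
      have h1 : |L x j / r| ≤ 1 := by
        rw [abs_div, abs_of_pos (one_pos.trans_le hr), div_le_one (one_pos.trans_le hr), ← hx,
          ← L.norm_map x]
        exact PiLp.norm_apply_le (L x) j
      rw [abs_pow]
      have := pow_le_one₀ (n := n) (abs_nonneg _) h1
      linarith)
    (fun θ hθ a => by
      simp only [hw, Finset.sum_div, mul_div_assoc, mul_one]
      exact (tendsto_finsetSum _ fun i _ => (chart_div_tendsto hθ a i).const_mul (w i)).pow n)
  simpa only [one_mul, integral_exp_sum_quadratic hκ] using h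

theorem isEquivalent_derivTau (hγ : 0 ≤ γ) (hκ : ∀ i, 0 < κ i)
    (hM : ∀ i, M i → κ i = γ / 2 ∧ ν i = 0)
    (hL : ∀ x, exponent lam tau (L x) = Λ * ‖x‖ ^ 2 + phase M γ i₀ κ ν x)
    (hmass : angularMass γ i₀ ≠ 0) (j : {i // ¬ P i}) (hj : ∀ x, L x j = x j) (hMj : ¬ M j)
    (hν : ν j = tau j) :
    derivTau lam tau j ~[atTop] fun r => tau j / (2 * κ j) * integral lam tau r := by
  -- With a zero coefficient the equivalence demands exact vanishing, which the reflection symmetry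
  -- provides.
  by_cases h0 : tau j = 0
  · refine EventuallyEq.isEquivalent ?_
    filter_upwards [eventually_gt_atTop 0] with r hr
    rw [derivTau_eq_zero lam tau h0 hr, h0, zero_div, zero_mul]
  have hκj := hκ j
  have h := isEquivalent_of_tendsto_mul (k := fun _ => 1) (c := tau j / (2 * κ j))
    (D := derivTau lam tau j) ((eventually_gt_atTop 0).mono fun r hr => growthInv_ne_zero hr)
    (tendsto_integral hγ hκ hM hL)
    (by simpa only [hν, mul_left_comm] using tendsto_moment_coord hγ hκ hM hL j hj)
    (mul_ne_zero hmass (gaussMass_pos hκ ν).ne') (by positivity)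
    ((eventually_gt_atTop 0).mono fun r hr => by
      simp [derivTau_eq_moment lam tau j hr, scale, hMj])
  simpa only [one_mul] using h

/-- This serves two kinds of index: transversal ones, with scale `1`, and those below `m` with `tau
j = 0` in the shifted case, where `scale ^ 2 = r` and `κ j = γ / 2` give `r / γ`. -/
theorem isEquivalent_derivLam (hγ : 0 ≤ γ) (hκ : ∀ i, 0 < κ i)
    (hM : ∀ i, M i → κ i = γ / 2 ∧ ν i = 0)
    (hL : ∀ x, exponent lam tau (L x) = Λ * ‖x‖ ^ 2 + phase M γ i₀ κ ν x)
    (hmass : angularMass γ i₀ ≠ 0) (j : {i // ¬ P i}) (hj : ∀ x, L x j = x j) :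
    derivLam lam tau j ~[atTop] fun r =>
      scale M r j ^ 2 * (1 / (2 * κ j) + ν j ^ 2 / (4 * κ j ^ 2)) * integral lam tau r := by
  have hκj := hκ j
  refine isEquivalent_of_tendsto_mul
    ((eventually_gt_atTop 0).mono fun r hr => growthInv_ne_zero hr)
    (tendsto_integral hγ hκ hM hL)
    (by simpa only [mul_left_comm] using tendsto_moment_coord_sq hγ hκ hM hL j hj)
    (mul_ne_zero hmass (gaussMass_pos hκ ν).ne') (by positivity)
    ((eventually_gt_atTop 0).mono fun r hr => ?_)
  have hs := (scale_pos (M := M) hr j).ne'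
  rw [derivLam_eq_moment lam tau j hr, ← moment_const_mul]
  congr 1
  ext t
  field_simp

end Laplace

/-! ### Products and sums over blocks of indices. -/

section Combinatorics

variable {d m : ℕ}

theorem prod_subtype_not_lt (F : Fin d → ℝ) :
    ∏ i : {i : Fin d // ¬ (i : ℕ) < m}, F i =
      ∏ i ∈ Finset.univ.filter (fun i : Fin d => m ≤ (i : ℕ)), F i :=
  (Finset.prod_subtype _ (by simp) F).symm

theorem sum_subtype_not_lt (F : Fin d → ℝ) :
    ∑ i : {i : Fin d // ¬ (i : ℕ) < m}, F i =
      ∑ i ∈ Finset.univ.filter (fun i : Fin d => m ≤ (i : ℕ)), F i :=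
  (Finset.sum_subtype _ (by simp) F).symm

theorem card_filter_lt (hmd : m ≤ d) :
    (Finset.univ.filter (fun i : Fin d => (i : ℕ) < m)).card = m := by
  rw [Fin.card_filter_val_lt, min_eq_right hmd]

theorem card_filter_ge (hmd : m ≤ d) :
    (Finset.univ.filter (fun i : Fin d => m ≤ (i : ℕ))).card = d - m := by
  have h := Finset.card_filter_add_card_filter_not (s := (Finset.univ : Finset (Fin d)))
    (fun i : Fin d => (i : ℕ) < m)
  simp only [not_lt, card_filter_lt hmd, Finset.card_univ, Fintype.card_fin] at h
  omega

theorem card_subtype_lt (hmd : m ≤ d) : Fintype.card {i : Fin d // (i : ℕ) < m} = m := by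
  rw [Fintype.card_subtype, card_filter_lt hmd]

/-- A product over all indices but `i₀` of a function that is constant below `m`. -/
theorem prod_subtype_ne (hmd : m ≤ d) {i₀ : Fin d} (hi₀ : (i₀ : ℕ) < m) {F : Fin d → ℝ} {c : ℝ}
    (hF : ∀ i : Fin d, (i : ℕ) < m → F i = c) :
    ∏ i : {i : Fin d // ¬ i = i₀}, F i =
      c ^ (m - 1) * ∏ i ∈ Finset.univ.filter (fun i : Fin d => m ≤ (i : ℕ)), F i := by
  rw [← Finset.prod_subtype (Finset.univ.erase i₀) (by simp) F,
    ← Finset.prod_filter_mul_prod_filter_not _ (fun i : Fin d => (i : ℕ) < m)]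
  congr 1
  · rw [Finset.filter_erase, Finset.prod_congr rfl (g := fun _ => c), Finset.prod_const,
      Finset.card_erase_of_mem (by simpa using hi₀), card_filter_lt hmd]
    intro i hi
    exact hF i (by simpa using (Finset.mem_erase.1 hi).2)
  · refine Finset.prod_congr ?_ fun _ _ => rfl
    ext i
    simp only [Finset.mem_filter, Finset.mem_erase, Finset.mem_univ, and_true, true_and, not_lt]
    refine ⟨fun h => h.2, fun h => ⟨?_, h⟩⟩
    rintro rfl
    omega

theorem sqrt_pow_eq_rpow {x : ℝ} (hx : 0 ≤ x) (n : ℕ) : Real.sqrt x ^ n = x ^ ((n : ℝ) / 2) := by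
  rw [Real.sqrt_eq_rpow, ← Real.rpow_natCast, ← Real.rpow_mul hx]
  congr 1
  ring

theorem prod_gauss_filter (hmd : m ≤ d) (lam tau : Fin d → ℝ) (lam₁ : ℝ) :
    ∏ i ∈ Finset.univ.filter (fun i : Fin d => m ≤ (i : ℕ)),
        (Real.sqrt (Real.pi / (lam₁ - lam i)) * Real.exp (tau i ^ 2 / (4 * (lam₁ - lam i)))) =
      Real.exp (-∑ i ∈ Finset.univ.filter (fun i : Fin d => m ≤ (i : ℕ)),
          tau i ^ 2 / (4 * (lam i - lam₁))) *
        (Real.pi ^ (((d : ℝ) - m) / 2) /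
          ∏ i ∈ Finset.univ.filter (fun i : Fin d => m ≤ (i : ℕ)), Real.sqrt (lam₁ - lam i)) := by
  simp_rw [Real.sqrt_div Real.pi_pos.le]
  rw [Finset.prod_mul_distrib, Finset.prod_div_distrib, Finset.prod_const, card_filter_ge hmd,
    ← Real.exp_sum, sqrt_pow_eq_rpow Real.pi_pos.le, Nat.cast_sub hmd, mul_comm,
    ← Finset.sum_neg_distrib]
  congr 2
  refine Finset.sum_congr rfl fun i _ => ?_
  rw [← neg_sub lam₁ (lam i), mul_neg, div_neg, neg_neg]

end Combinatorics

/-! ### Adapted coordinates. -/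

section Adapted

variable {d m : ℕ} {lam tau : Fin d → ℝ} {lam₁ : ℝ}

theorem exponent_eq_of_coords (heq : ∀ i : Fin d, (i : ℕ) < m → lam i = lam₁)
    (t : EuclideanSpace ℝ (Fin d)) :
    exponent lam tau t = lam₁ * ‖t‖ ^ 2 +
      (∑ i ∈ Finset.univ.filter (fun i : Fin d => (i : ℕ) < m), tau i * t i +
      ∑ i ∈ Finset.univ.filter (fun i : Fin d => m ≤ (i : ℕ)),
        (-(lam₁ - lam i) * t i ^ 2 + tau i * t i)) := by
  rw [exponent, EuclideanSpace.real_norm_sq_eq, Finset.mul_sum,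
    ← Finset.sum_filter_add_sum_filter_not Finset.univ (fun i : Fin d => (i : ℕ) < m)
      fun i => lam i * t i ^ 2,
    ← Finset.sum_filter_add_sum_filter_not Finset.univ (fun i : Fin d => (i : ℕ) < m)
      fun i => tau i * t i,
    ← Finset.sum_filter_add_sum_filter_not Finset.univ (fun i : Fin d => (i : ℕ) < m)
      fun i => lam₁ * t i ^ 2]
  simp only [not_lt]
  have h : ∑ i ∈ Finset.univ.filter (fun i : Fin d => (i : ℕ) < m), lam i * t i ^ 2 =
      ∑ i ∈ Finset.univ.filter (fun i : Fin d => (i : ℕ) < m), lam₁ * t i ^ 2 :=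
    Finset.sum_congr rfl fun i hi => by rw [heq i (by simpa using hi)]
  simp only [neg_mul, sub_mul, Finset.sum_add_distrib, Finset.sum_neg_distrib,
    Finset.sum_sub_distrib]
  rw [h]
  ring

/-- An isometry taking the direction `i₀` to `(τ_1, …, τ_m, 0, …, 0) / γ` and preserving the
coordinates `i ≥ m` and those with `τ_i = 0`. -/
theorem exists_adapted_isometry {i₀ : Fin d} (hi₀ : (i₀ : ℕ) < m) (hτ : tau i₀ ≠ 0) {γ : ℝ}
    (hγ : 0 < γ)
    (hγ2 : γ ^ 2 = ∑ i ∈ Finset.univ.filter (fun i : Fin d => (i : ℕ) < m), tau i ^ 2) :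
    ∃ L : EuclideanSpace ℝ (Fin d) ≃ₗᵢ[ℝ] EuclideanSpace ℝ (Fin d),
      (∀ x (i : Fin d), m ≤ (i : ℕ) ∨ tau i = 0 → L x i = x i) ∧
      (∀ x, γ * x i₀ =
        ∑ i ∈ Finset.univ.filter (fun i : Fin d => (i : ℕ) < m), tau i * L x i) ∧
      ∀ j : Fin d, (j : ℕ) < m →
        ∃ w : Fin d → ℝ, w i₀ = tau j / γ ∧ ∀ x, L x j = ∑ i, w i * x i := by
  let u : EuclideanSpace ℝ (Fin d) := WithLp.toLp 2 fun i => if (i : ℕ) < m then tau i / γ else 0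
  let v : Fin d → EuclideanSpace ℝ (Fin d) := fun i =>
    if i = i₀ then u else EuclideanSpace.single i 1
  -- `s` holds `i₀` and the directions to be kept. The unit vector `u` vanishes on the latter, so
  -- `v` is orthonormal on `s` and extends to an orthonormal basis `b`; the isometry sends the
  -- `i`-th standard vector to `b i`. Since `tau i₀ ≠ 0`, the index `i₀` is not among the kept
  -- directions.
  let s : Set (Fin d) := {i | i = i₀ ∨ m ≤ (i : ℕ) ∨ tau i = 0}
  have huu : inner ℝ u u = 1 := by
    rw [real_inner_self_eq_norm_sq, EuclideanSpace.real_norm_sq_eq]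
    simp only [u, ite_pow, div_pow, zero_pow two_ne_zero]
    rw [← Finset.sum_filter, ← Finset.sum_div, ← hγ2, div_self (by positivity)]
  have hui : ∀ i, i ∈ s → i ≠ i₀ → u i = 0 := by
    intro i hi hne
    rcases hi with h | h | h
    · exact absurd h hne
    · simp [u, h]
    · simp [u, h]
  have hort : Orthonormal ℝ fun i : s => v i := by
    rw [orthonormal_iff_ite]
    rintro ⟨i, hi⟩ ⟨j, hj⟩
    simp only [v, Subtype.mk.injEq]
    by_cases h1 : i = i₀ <;> by_cases h2 : j = i₀
    · rw [if_pos h1, if_pos h2, if_pos (h1.trans h2.symm), huu]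
    · rw [if_pos h1, if_neg h2, if_neg (fun h : i = j => h2 (h.symm.trans h1)), EuclideanSpace.inner_single_right]
      simp [hui j hj h2]
    · rw [if_neg h1, if_pos h2, if_neg (fun h : i = j => h1 (h.trans h2)), EuclideanSpace.inner_single_left]
      simp [hui i hi h1]
    · rw [if_neg h1, if_neg h2, EuclideanSpace.inner_single_left]
      simp
  obtain ⟨b, hb⟩ := Orthonormal.exists_orthonormalBasis_extension_of_card_eq (v := v) (s := s)
    (by simp) hort
  have hx : ∀ x i, x i = inner ℝ (b i) (b.repr.symm x) := fun x i => by
    rw [← b.repr_apply_apply, LinearIsometryEquiv.apply_symm_apply]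
  have hbu : b i₀ = u := by
    rw [hb i₀ (Or.inl rfl)]
    simp [v]
  -- The witness `w` lists the coordinates of the `j`-th standard vector in `b`; its entry at `i₀`
  -- is `u j`.
  refine ⟨b.repr.symm, fun x i hi => ?_, fun x => ?_, fun j hj =>
    ⟨b.repr (EuclideanSpace.single j 1), ?_, fun x => ?_⟩⟩
  · have hne : i ≠ i₀ := by
      rintro rfl
      rcases hi with h | h
      · omega
      · exact hτ h
    rw [hx x i, hb i (Or.inr hi)]
    simp [v, hne, EuclideanSpace.inner_single_left]
  · rw [hx x i₀, hbu, PiLp.inner_apply, Finset.mul_sum, Finset.sum_filter]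
    refine Finset.sum_congr rfl fun i _ => ?_
    by_cases h : (i : ℕ) < m
    · simp only [u, h, if_true, RCLike.inner_apply, conj_trivial]
      field_simp
    · simp [u, h]
  · rw [b.repr_apply_apply, hbu]
    simp [EuclideanSpace.inner_single_right, u, hj]
  · have h := b.repr.symm.inner_map_map (b.repr (EuclideanSpace.single j 1)) x
    rw [LinearIsometryEquiv.symm_apply_apply, EuclideanSpace.inner_single_left,
      PiLp.inner_apply] at h
    simp only [map_one, one_mul, RCLike.inner_apply, conj_trivial] at h
    rw [h]
    exact Finset.sum_congr rfl fun i _ => mul_comm _ _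

end Adapted

/-! ### The case of vanishing linear part below `m`. -/

section Centred

variable {d m : ℕ} {lam tau : Fin d → ℝ} {lam₁ : ℝ}

theorem exponent_eq_phase_of_tau_eq_zero (heq : ∀ i : Fin d, (i : ℕ) < m → lam i = lam₁)
    (hτ : ∀ i : Fin d, (i : ℕ) < m → tau i = 0) (i₀ : {i : Fin d // (i : ℕ) < m})
    (x : EuclideanSpace ℝ (Fin d)) :
    exponent lam tau x = lam₁ * ‖x‖ ^ 2 +
      phase (P := fun i : Fin d => (i : ℕ) < m) (fun _ => False) 0 i₀ (fun i => lam₁ - lam i)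
        (fun i => tau i) x := by
  rw [exponent_eq_of_coords heq, phase]
  simp only [if_false, zero_mul]
  rw [sum_subtype_not_lt fun i => -(lam₁ - lam i) * x i ^ 2 + tau i * x i, Finset.sum_eq_zero]
  intro i hi
  rw [hτ i (by simpa using hi), zero_mul]

theorem angularMass_zero (hmd : m ≤ d) (i₀ : {i : Fin d // (i : ℕ) < m}) :
    angularMass (P := fun i : Fin d => (i : ℕ) < m) 0 i₀ = unitSphereVolume m := by
  have : Nonempty {i : Fin d // (i : ℕ) < m} := ⟨i₀⟩
  simp only [angularMass, true_or, if_true]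
  rw [integral_const, toSphere_real_univ, card_subtype_lt hmd, smul_eq_mul, mul_one]

/-- Each of the `d - m` transversal coordinates costs a factor `1 / r`. -/
theorem growth_centred (hm : 1 ≤ m) (hmd : m ≤ d) {r : ℝ} (hr : 0 < r) :
    r ^ (d - 1) * ∏ i, scale (P := fun i : Fin d => (i : ℕ) < m) (fun _ => False) r i / r =
      r ^ (m - 1) := by
  simp only [scale, if_false]
  rw [prod_subtype_not_lt fun _ => 1 / r, Finset.prod_const, card_filter_ge hmd, one_div, inv_pow,
    ← div_eq_mul_inv, div_eq_iff (by positivity), ← pow_add]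
  congr 1
  omega

end Centred

/-! ### The case of nonzero linear part below `m`. -/

section Shifted

variable {d m : ℕ} {lam tau : Fin d → ℝ} {lam₁ : ℝ}

/-- Of the two points of the zero-dimensional sphere only `+1` counts, with mass one. -/
theorem angularMass_of_unique {γ : ℝ} (hγ : γ ≠ 0) (i₀ : Fin d) :
    angularMass (P := fun i : Fin d => i = i₀) γ ⟨i₀, rfl⟩ = 1 := by
  simp only [angularMass, hγ, false_or]
  exact @integral_toSphere_unique {i : Fin d // i = i₀} (Subtype.fintype _) _

/-- The `m - 1` directions on the scale `√r` cost `r ^ (-1 / 2)` each, the `d - m` others `1 / r`.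
-/
theorem growth_shifted (hmd : m ≤ d) {i₀ : Fin d} (hi₀ : (i₀ : ℕ) < m) {r : ℝ} (hr : 0 < r) :
    r ^ (d - 1) *
      ∏ i, scale (P := fun i : Fin d => i = i₀) (fun i => ((i : Fin d) : ℕ) < m) r i / r =
      r ^ (((m : ℝ) - 1) / 2) := by
  have h := prod_subtype_ne hmd hi₀ (F := fun i : Fin d => (if (i : ℕ) < m then Real.sqrt r else 1) / r)
    (c := Real.sqrt r / r) fun i hi => by simp [hi]
  simp only [scale]
  rw [h, Finset.prod_congr rfl (g := fun _ => 1 / r), Finset.prod_const, card_filter_ge hmd, div_pow,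
    sqrt_pow_eq_rpow hr.le, Nat.cast_sub (by omega), Nat.cast_one]
  · have e : r ^ (d - 1) = r ^ (m - 1) * r ^ (d - m) := by
      rw [← pow_add]
      congr 1
      omega
    rw [e, one_div, inv_pow]
    field_simp
  · intro i hi
    have : ¬ (i : ℕ) < m := by simpa using hi
    simp [this]

/-- Each of the `m - 1` tangential Gaussians, with `κ = γ / 2`, contributes `√(2 * π / γ)`. -/
theorem gaussMass_shifted (hmd : m ≤ d) {i₀ : Fin d} (hi₀ : (i₀ : ℕ) < m) {γ : ℝ} (hγ : 0 < γ) :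
    gaussMass (fun i : {i : Fin d // ¬ i = i₀} => if (i : ℕ) < m then γ / 2 else lam₁ - lam i)
        (fun i => if (i : ℕ) < m then 0 else tau i) =
      (2 / γ) ^ (((m : ℝ) - 1) / 2) *
      (Real.exp (-∑ i ∈ Finset.univ.filter (fun i : Fin d => m ≤ (i : ℕ)),
          tau i ^ 2 / (4 * (lam i - lam₁))) *
        (Real.pi ^ (((d : ℝ) - 1) / 2) /
          ∏ i ∈ Finset.univ.filter (fun i : Fin d => m ≤ (i : ℕ)), Real.sqrt (lam₁ - lam i))) := by
  have h := prod_subtype_ne hmd hi₀ (F := fun i : Fin d =>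
    Real.sqrt (Real.pi / (if (i : ℕ) < m then γ / 2 else lam₁ - lam i)) *
      Real.exp ((if (i : ℕ) < m then 0 else tau i) ^ 2 /
        (4 * (if (i : ℕ) < m then γ / 2 else lam₁ - lam i))))
    (c := Real.sqrt (2 / γ * Real.pi)) fun i hi => by
      simp only [hi, if_true]
      norm_num
      congr 1
      field_simp
  rw [gaussMass, h, Finset.prod_congr rfl (g := fun i =>
    Real.sqrt (Real.pi / (lam₁ - lam i)) * Real.exp (tau i ^ 2 / (4 * (lam₁ - lam i)))),
    prod_gauss_filter hmd, sqrt_pow_eq_rpow (by positivity),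
    Real.mul_rpow (by positivity) Real.pi_pos.le, Nat.cast_sub (by omega), Nat.cast_one]
  · have e : Real.pi ^ (((d : ℝ) - 1) / 2) =
        Real.pi ^ (((m : ℝ) - 1) / 2) * Real.pi ^ (((d : ℝ) - m) / 2) := by
      rw [← Real.rpow_add Real.pi_pos]
      congr 1
      ring
    rw [e]
    ring
  · intro i hi
    have : ¬ (i : ℕ) < m := by simpa using hi
    simp only [this, if_false]

theorem exponent_eq_phase_shifted (heq : ∀ i : Fin d, (i : ℕ) < m → lam i = lam₁)
    {i₀ : Fin d} (hi₀ : (i₀ : ℕ) < m) {γ : ℝ}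
    {L : EuclideanSpace ℝ (Fin d) ≃ₗᵢ[ℝ] EuclideanSpace ℝ (Fin d)}
    (hL : ∀ x (i : Fin d), m ≤ (i : ℕ) → L x i = x i)
    (hLγ : ∀ x, γ * x i₀ =
        ∑ i ∈ Finset.univ.filter (fun i : Fin d => (i : ℕ) < m), tau i * L x i)
    (x : EuclideanSpace ℝ (Fin d)) :
    exponent lam tau (L x) = lam₁ * ‖x‖ ^ 2 +
      phase (P := fun i : Fin d => i = i₀) (fun i => ((i : Fin d) : ℕ) < m) γ ⟨i₀, rfl⟩
        (fun i => if (i : ℕ) < m then γ / 2 else lam₁ - lam i)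
        (fun i => if (i : ℕ) < m then 0 else tau i) x := by
  rw [exponent_eq_of_coords heq, L.norm_map, phase, ← hLγ]
  congr 2
  rw [← Finset.sum_subtype (Finset.univ.erase i₀) (by simp)
    (fun i : Fin d => if (i : ℕ) < m then 0 else
      (-(if (i : ℕ) < m then γ / 2 else lam₁ - lam i) * x i ^ 2 +
        (if (i : ℕ) < m then 0 else tau i) * x i)),
    Finset.sum_erase _ (by simp [hi₀]), Finset.sum_filter]
  refine Finset.sum_congr rfl fun i _ => ?_
  by_cases hi : (i : ℕ) < m
  · simp [hi]
  · simp [hi, hL x i (not_lt.1 hi)]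

end Shifted

/-! ### The two families of asymptotics. -/

section Main

variable {d m : ℕ} {lam tau : Fin d → ℝ} {lam₁ : ℝ}

theorem transversal_coeff (a b c : ℝ) : a / (2 * (b - c)) = -(a / (2 * (c - b))) := by
  rw [← neg_sub c b, mul_neg, div_neg]

theorem asymptotics_centred (hm : 1 ≤ m) (hmd : m ≤ d)
    (heq : ∀ i : Fin d, (i : ℕ) < m → lam i = lam₁)
    (hlt : ∀ i : Fin d, m ≤ (i : ℕ) → lam i < lam₁)
    (hτ : ∀ i : Fin d, (i : ℕ) < m → tau i = 0) :
    (integral lam tau ~[atTop] fun r =>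
        r ^ (m - 1) * unitSphereVolume m *
          Real.exp (r ^ 2 * lam₁ -
            ∑ i ∈ Finset.univ.filter (fun i : Fin d => m ≤ (i : ℕ)),
              tau i ^ 2 / (4 * (lam i - lam₁))) *
          (Real.pi ^ (((d : ℝ) - m) / 2) /
            ∏ i ∈ Finset.univ.filter (fun i : Fin d => m ≤ (i : ℕ)),
              Real.sqrt (lam₁ - lam i))) ∧
      (∀ j : Fin d, (j : ℕ) < m →
        derivLam lam tau j ~[atTop] fun r => r ^ 2 / m * integral lam tau r) ∧
      (∀ j : Fin d, m ≤ (j : ℕ) →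
        derivTau lam tau j ~[atTop] fun r =>
          -(tau j / (2 * (lam j - lam₁))) * integral lam tau r) ∧
      (∀ j : Fin d, m ≤ (j : ℕ) →
        derivLam lam tau j ~[atTop] fun r =>
          (1 / (2 * (lam₁ - lam j)) + tau j ^ 2 / (4 * (lam j - lam₁) ^ 2)) *
            integral lam tau r) := by
  -- With `γ = 0` the choice of `i₀` is immaterial.
  let i₀ : {i : Fin d // (i : ℕ) < m} := ⟨⟨0, by omega⟩, hm⟩
  have hne : Nonempty {i : Fin d // (i : ℕ) < m} := ⟨i₀⟩
  let κ : {i : Fin d // ¬ (i : ℕ) < m} → ℝ := fun i => lam₁ - lam i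
  let ν : {i : Fin d // ¬ (i : ℕ) < m} → ℝ := fun i => tau i
  have hκ : ∀ i, 0 < κ i := fun i => sub_pos.2 (hlt i (not_lt.1 i.2))
  have hM : ∀ i : {i : Fin d // ¬ (i : ℕ) < m}, False → κ i = 0 / 2 ∧ ν i = 0 :=
    fun _ h => h.elim
  let L := LinearIsometryEquiv.refl ℝ (EuclideanSpace ℝ (Fin d))
  have hL : ∀ x, exponent lam tau (L x) = lam₁ * ‖x‖ ^ 2 +
      phase (P := fun i : Fin d => (i : ℕ) < m) (fun _ => False) 0 i₀ κ ν x :=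
    exponent_eq_phase_of_tau_eq_zero heq hτ i₀
  have hLj : ∀ (j : Fin d) (x : EuclideanSpace ℝ (Fin d)), L x j = x j := fun _ _ => rfl
  have hmass := angularMass_zero hmd i₀
  have hS : 0 < unitSphereVolume m := unitSphereVolume_pos hm
  have hG : 0 < gaussMass κ ν := gaussMass_pos hκ ν
  have hmass0 : angularMass (P := fun i : Fin d => (i : ℕ) < m) 0 i₀ ≠ 0 := by
    rw [hmass]
    exact hS.ne'
  have hf := tendsto_integral le_rfl hκ hM hL
  have hw : ∀ᶠ r in atTop, growthInv (P := fun i : Fin d => (i : ℕ) < m)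
      (fun _ => False) 0 lam₁ r ≠ 0 :=
    (eventually_gt_atTop 0).mono fun r hr => growthInv_ne_zero hr
  refine ⟨?_, fun j hj => ?_, fun j hj => ?_, fun j hj => ?_⟩
  · refine isEquivalent_of_tendsto_inv hf (mul_ne_zero hmass0 hG.ne') ?_ hw
    filter_upwards [eventually_gt_atTop 0] with r hr
    have hGeq : gaussMass κ ν = _ := (prod_subtype_not_lt fun i => Real.sqrt (Real.pi / (lam₁ - lam i)) *
      Real.exp (tau i ^ 2 / (4 * (lam₁ - lam i)))).trans (prod_gauss_filter hmd lam tau lam₁)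
    rw [growthInv, growth_centred hm hmd hr, hmass, hGeq, sub_eq_add_neg, Real.exp_add, zero_mul,
      neg_zero, Real.exp_zero, Real.exp_neg (lam₁ * r ^ 2), mul_comm (r ^ 2) lam₁]
    have hr' : r ^ (m - 1) ≠ 0 := by positivity
    field_simp
  · have h := tendsto_moment_div_pow le_rfl hκ hM hL j (w := fun i => if i = j then 1 else 0)
      (fun x => by simp [hLj]) 2
    simp only [true_or, if_true, one_mul, ite_mul, zero_mul, Finset.sum_ite_eq',
      Finset.mem_univ] at h
    -- The factor `1 / m` is the mean of `θ j ^ 2` on the limiting sphere.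
    have hsq := integral_toSphere_sq (⟨j, hj⟩ : {i : Fin d // (i : ℕ) < m})
    simp_rw [fun x : EuclideanSpace ℝ {i : Fin d // (i : ℕ) < m} => join_apply_of_pos x 0 hj] at h
    rw [hsq, card_subtype_lt hmd] at h
    have hm0 : (m : ℝ) ≠ 0 := by positivity
    have h' := isEquivalent_of_tendsto_mul (k := fun r => r ^ 2) (c := 1 / (m : ℝ))
      (D := derivLam lam tau j) hw hf
      (by
        rw [hmass]
        convert h using 2
        ring)
      (mul_ne_zero hmass0 hG.ne') (by positivity)
      ((eventually_gt_atTop 0).mono fun r hr => by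
        rw [derivLam_eq_moment lam tau j hr, ← moment_const_mul]
        congr 1
        ext t
        field_simp)
    simpa only [mul_one_div] using h'
  · have h := isEquivalent_derivTau le_rfl hκ hM hL hmass0 ⟨j, not_lt.2 hj⟩ (hLj j) not_false rfl
    simpa only [κ, transversal_coeff (tau j) lam₁ (lam j)] using h
  · have h := isEquivalent_derivLam le_rfl hκ hM hL hmass0 ⟨j, not_lt.2 hj⟩ (hLj j)
    simpa only [κ, ν, scale, if_false, one_pow, one_mul, sub_sq_comm lam₁ (lam j)] using h

theorem asymptotics_shifted (hmd : m ≤ d)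
    (heq : ∀ i : Fin d, (i : ℕ) < m → lam i = lam₁)
    (hlt : ∀ i : Fin d, m ≤ (i : ℕ) → lam i < lam₁)
    (hτ : ∃ i : Fin d, (i : ℕ) < m ∧ tau i ≠ 0) {γ : ℝ}
    (hγ : γ = Real.sqrt (∑ i ∈ Finset.univ.filter (fun i : Fin d => (i : ℕ) < m), tau i ^ 2)) :
    (integral lam tau ~[atTop] fun r =>
        Real.exp (r ^ 2 * lam₁ + r * γ -
            ∑ i ∈ Finset.univ.filter (fun i : Fin d => m ≤ (i : ℕ)),
              tau i ^ 2 / (4 * (lam i - lam₁))) *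
          (2 * r / γ) ^ (((m : ℝ) - 1) / 2) *
          (Real.pi ^ (((d : ℝ) - 1) / 2) /
            ∏ i ∈ Finset.univ.filter (fun i : Fin d => m ≤ (i : ℕ)),
              Real.sqrt (lam₁ - lam i))) ∧
      (∀ j : Fin d, (j : ℕ) < m → tau j ≠ 0 →
        derivTau lam tau j ~[atTop] fun r => r * (tau j / γ) * integral lam tau r) ∧
      (∀ j : Fin d, (j : ℕ) < m → tau j ≠ 0 →
        derivLam lam tau j ~[atTop] fun r =>
          r ^ 2 * (tau j ^ 2 / γ ^ 2) * integral lam tau r) ∧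
      (∀ j : Fin d, (j : ℕ) < m → tau j = 0 →
        derivLam lam tau j ~[atTop] fun r => r / γ * integral lam tau r) ∧
      (∀ j : Fin d, m ≤ (j : ℕ) →
        derivTau lam tau j ~[atTop] fun r =>
          -(tau j / (2 * (lam j - lam₁))) * integral lam tau r) ∧
      (∀ j : Fin d, m ≤ (j : ℕ) →
        derivLam lam tau j ~[atTop] fun r =>
          (1 / (2 * (lam₁ - lam j)) + tau j ^ 2 / (4 * (lam j - lam₁) ^ 2)) *
            integral lam tau r) := by
  obtain ⟨i₀, hi₀, hτ₀⟩ := hτ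
  have hsum : 0 < ∑ i ∈ Finset.univ.filter (fun i : Fin d => (i : ℕ) < m), tau i ^ 2 :=
    Finset.sum_pos' (fun _ _ => sq_nonneg _) ⟨i₀, by simpa using hi₀, by positivity⟩
  have hγ0 : 0 < γ := by
    rw [hγ]
    positivity
  have hγ2 : γ ^ 2 = ∑ i ∈ Finset.univ.filter (fun i : Fin d => (i : ℕ) < m), tau i ^ 2 := by
    rw [hγ, Real.sq_sqrt hsum.le]
  obtain ⟨L, hL1, hL2, hL3⟩ := exists_adapted_isometry hi₀ hτ₀ hγ0 hγ2
  let κ : {i : Fin d // ¬ i = i₀} → ℝ := fun i => if (i : ℕ) < m then γ / 2 else lam₁ - lam i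
  let ν : {i : Fin d // ¬ i = i₀} → ℝ := fun i => if (i : ℕ) < m then 0 else tau i
  have hκ : ∀ i, 0 < κ i := by
    intro i
    simp only [κ]
    split_ifs with h
    · positivity
    · exact sub_pos.2 (hlt i (not_lt.1 h))
  have hM : ∀ i : {i : Fin d // ¬ i = i₀}, ((i : Fin d) : ℕ) < m → κ i = γ / 2 ∧ ν i = 0 :=
    fun i hi => ⟨if_pos hi, if_pos hi⟩
  have hL : ∀ x, exponent lam tau (L x) = lam₁ * ‖x‖ ^ 2 +
      phase (P := fun i : Fin d => i = i₀) (fun i => ((i : Fin d) : ℕ) < m) γ ⟨i₀, rfl⟩ κ ν x :=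
    exponent_eq_phase_shifted heq hi₀ (fun x i hi => hL1 x i (Or.inl hi)) hL2
  have hmass := angularMass_of_unique hγ0.ne' i₀
  have hmass0 : angularMass (P := fun i : Fin d => i = i₀) γ ⟨i₀, rfl⟩ ≠ 0 := by
    rw [hmass]
    exact one_ne_zero
  have hG : 0 < gaussMass κ ν := gaussMass_pos hκ ν
  have hf := tendsto_integral hγ0.le hκ hM hL
  have hw : ∀ᶠ r in atTop, growthInv (P := fun i : Fin d => i = i₀)
      (fun i => ((i : Fin d) : ℕ) < m) γ lam₁ r ≠ 0 :=
    (eventually_gt_atTop 0).mono fun r hr => growthInv_ne_zero hr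
  have hne : ∀ j : Fin d, m ≤ (j : ℕ) → ¬ j = i₀ := by
    rintro j hj rfl
    omega
  -- To leading order the point sits at `r` times the unit vector of the linear part, whose
  -- coordinates are `tau j / γ`.
  have hpow : ∀ j : Fin d, (j : ℕ) < m → ∀ n : ℕ,
      Tendsto (fun r => growthInv (P := fun i : Fin d => i = i₀)
        (fun i => ((i : Fin d) : ℕ) < m) γ lam₁ r * moment lam tau (fun t => (t j / r) ^ n) r) atTop
        (𝓝 ((tau j / γ) ^ n *
          (angularMass (P := fun i : Fin d => i = i₀) γ ⟨i₀, rfl⟩ * gaussMass κ ν))) := by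
    intro j hj n
    obtain ⟨w, hw0, hwj⟩ := hL3 j hj
    convert tendsto_moment_div_pow hγ0.le hκ hM hL j hwj n using 2
    rw [← mul_assoc]
    congr 1
    rw [angularMass, ← integral_const_mul]
    refine integral_congr_ae (.of_forall fun θ => ?_)
    simp only [hγ0.ne', false_or]
    split_ifs with hθ
    · rw [mul_one, one_mul, Finset.sum_eq_single i₀, hw0,
        join_apply_of_pos (P := fun i : Fin d => i = i₀) _ _ rfl, hθ, mul_one]
      · intro i _ hi
        rw [join_apply_of_neg (P := fun i : Fin d => i = i₀) _ _ hi, Pi.zero_apply, mul_zero]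
      · simp
    · simp
  refine ⟨?_, fun j hj hτj => ?_, fun j hj hτj => ?_, fun j hj hτj => ?_, fun j hj => ?_,
    fun j hj => ?_⟩
  · refine isEquivalent_of_tendsto_inv hf (mul_ne_zero hmass0 hG.ne') ?_ hw
    filter_upwards [eventually_gt_atTop 0] with r hr
    rw [growthInv, growth_shifted hmd hi₀ hr, hmass, gaussMass_shifted hmd hi₀ hγ0,
      sub_eq_add_neg (r ^ 2 * lam₁ + r * γ), Real.exp_add, Real.exp_add, mul_comm γ r, mul_comm lam₁ (r ^ 2),
      Real.exp_neg (r * γ), Real.exp_neg (r ^ 2 * lam₁), mul_div_right_comm,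
      Real.mul_rpow (by positivity) hr.le]
    have hr' : r ^ (((m : ℝ) - 1) / 2) ≠ 0 := by positivity
    field_simp
  · refine isEquivalent_of_tendsto_mul (k := fun r => r) hw hf (by simpa using hpow j hj 1)
      (mul_ne_zero hmass0 hG.ne') (by positivity)
      ((eventually_gt_atTop 0).mono fun r hr => ?_)
    rw [derivTau_eq_moment lam tau j hr, ← moment_const_mul]
    congr 1
    ext t
    field_simp
  · have h := isEquivalent_of_tendsto_mul (k := fun r => r ^ 2) (D := derivLam lam tau j) hw hf
      (hpow j hj 2) (mul_ne_zero hmass0 hG.ne') (by positivity)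
      ((eventually_gt_atTop 0).mono fun r hr => by
        rw [derivLam_eq_moment lam tau j hr, ← moment_const_mul]
        congr 1
        ext t
        field_simp)
    simpa only [div_pow] using h
  -- Here `t j / r` tends to zero in the limit measure, so the scale `√r` is used instead; `L` fixes
  -- this coordinate because `tau j = 0`.
  · have hj0 : ¬ j = i₀ := by
      rintro rfl
      exact hτ₀ hτj
    have h := isEquivalent_derivLam hγ0.le hκ hM hL hmass0 ⟨j, hj0⟩
      (fun x => hL1 x j (Or.inr hτj))
    refine h.congr_right ?_
    filter_upwards [eventually_gt_atTop 0] with r hr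
    simp only [κ, ν, scale, hj, if_true, Real.sq_sqrt hr.le]
    field_simp
    ring
  · have h := isEquivalent_derivTau hγ0.le hκ hM hL hmass0 ⟨j, hne j hj⟩
      (fun x => hL1 x j (Or.inl hj)) (not_lt.2 hj) (if_neg (not_lt.2 hj))
    simpa only [κ, not_lt.2 hj, if_false,
      transversal_coeff (tau j) lam₁ (lam j)] using h
  · have h := isEquivalent_derivLam hγ0.le hκ hM hL hmass0 ⟨j, hne j hj⟩
      (fun x => hL1 x j (Or.inl hj))
    simpa only [κ, ν, scale, not_lt.2 hj, if_false, one_pow, one_mul,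
      sub_sq_comm lam₁ (lam j)] using h

end Main

end FisherBingham

end

theorem proposition2 {d m : ℕ} (hm : 1 ≤ m) (hmd : m ≤ d) (lam tau : Fin d → ℝ) (lam₁ : ℝ)
    (hneg : lam₁ < 0)
    (heq : ∀ i : Fin d, (i : ℕ) < m → lam i = lam₁)
    (hlt : ∀ i : Fin d, m ≤ (i : ℕ) → lam i < lam₁)
    (hanti : Antitone lam) :
    -- the partial derivatives exist
    (∀ r : ℝ, 0 < r → ∀ j : Fin d,
      DifferentiableAt ℝ
        (fun s => FisherBingham.integral (Function.update lam j s) tau r) (lam j) ∧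
      DifferentiableAt ℝ
        (fun s => FisherBingham.integral lam (Function.update tau j s) r) (tau j)) ∧
    -- the case `τ_1 = ⋯ = τ_m = 0`
    ((∀ i : Fin d, (i : ℕ) < m → tau i = 0) →
      (FisherBingham.integral lam tau ~[atTop] fun r =>
        r ^ (m - 1) * FisherBingham.unitSphereVolume m *
          Real.exp (r ^ 2 * lam₁ -
            ∑ i ∈ Finset.univ.filter (fun i : Fin d => m ≤ (i : ℕ)),
              tau i ^ 2 / (4 * (lam i - lam₁))) *
          (Real.pi ^ (((d : ℝ) - m) / 2) /
            ∏ i ∈ Finset.univ.filter (fun i : Fin d => m ≤ (i : ℕ)),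
              Real.sqrt (lam₁ - lam i))) ∧
      (∀ j : Fin d, (j : ℕ) < m →
        FisherBingham.derivLam lam tau j ~[atTop] fun r =>
          r ^ 2 / m * FisherBingham.integral lam tau r) ∧
      (∀ j : Fin d, (j : ℕ) < m → ∀ r : ℝ, 0 < r →
        FisherBingham.derivTau lam tau j r = 0) ∧
      (∀ j : Fin d, m ≤ (j : ℕ) →
        FisherBingham.derivTau lam tau j ~[atTop] fun r =>
          -(tau j / (2 * (lam j - lam₁))) * FisherBingham.integral lam tau r) ∧
      (∀ j : Fin d, m ≤ (j : ℕ) →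
        FisherBingham.derivLam lam tau j ~[atTop] fun r =>
          (1 / (2 * (lam₁ - lam j)) + tau j ^ 2 / (4 * (lam j - lam₁) ^ 2)) *
            FisherBingham.integral lam tau r)) ∧
    -- the case `(τ_1, …, τ_m) ≠ (0, …, 0)`
    ((∃ i : Fin d, (i : ℕ) < m ∧ tau i ≠ 0) →
      ∀ γ : ℝ, γ = Real.sqrt (∑ i ∈ Finset.univ.filter (fun i : Fin d => (i : ℕ) < m), tau i ^ 2) →
      (FisherBingham.integral lam tau ~[atTop] fun r =>
        Real.exp (r ^ 2 * lam₁ + r * γ -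
            ∑ i ∈ Finset.univ.filter (fun i : Fin d => m ≤ (i : ℕ)),
              tau i ^ 2 / (4 * (lam i - lam₁))) *
          (2 * r / γ) ^ (((m : ℝ) - 1) / 2) *
          (Real.pi ^ (((d : ℝ) - 1) / 2) /
            ∏ i ∈ Finset.univ.filter (fun i : Fin d => m ≤ (i : ℕ)),
              Real.sqrt (lam₁ - lam i))) ∧
      (∀ j : Fin d, (j : ℕ) < m → tau j ≠ 0 →
        FisherBingham.derivTau lam tau j ~[atTop] fun r =>
          r * (tau j / γ) * FisherBingham.integral lam tau r) ∧
      (∀ j : Fin d, (j : ℕ) < m → tau j ≠ 0 →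
        FisherBingham.derivLam lam tau j ~[atTop] fun r =>
          r ^ 2 * (tau j ^ 2 / γ ^ 2) * FisherBingham.integral lam tau r) ∧
      (∀ j : Fin d, (j : ℕ) < m → tau j = 0 → ∀ r : ℝ, 0 < r →
        FisherBingham.derivTau lam tau j r = 0) ∧
      (∀ j : Fin d, (j : ℕ) < m → tau j = 0 →
        FisherBingham.derivLam lam tau j ~[atTop] fun r =>
          r / γ * FisherBingham.integral lam tau r) ∧
      (∀ j : Fin d, m ≤ (j : ℕ) →
        FisherBingham.derivTau lam tau j ~[atTop] fun r =>
          -(tau j / (2 * (lam j - lam₁))) * FisherBingham.integral lam tau r) ∧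
      (∀ j : Fin d, m ≤ (j : ℕ) →
        FisherBingham.derivLam lam tau j ~[atTop] fun r =>
          (1 / (2 * (lam₁ - lam j)) + tau j ^ 2 / (4 * (lam j - lam₁) ^ 2)) *
            FisherBingham.integral lam tau r)) := by
  refine ⟨fun r hr j =>
    ⟨(FisherBingham.hasDerivAt_integral_lam lam tau j hr).differentiableAt,
      (FisherBingham.hasDerivAt_integral_tau lam tau j hr).differentiableAt⟩, fun hτ => ?_,
    fun hτ γ hγ => ?_⟩
  · obtain ⟨h1, h2, h3, h4⟩ := FisherBingham.asymptotics_centred hm hmd heq hlt hτ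
    exact ⟨h1, h2, fun j hj r hr => FisherBingham.derivTau_eq_zero lam tau (hτ j hj) hr, h3, h4⟩
  · obtain ⟨h1, h2, h3, h4, h5, h6⟩ := FisherBingham.asymptotics_shifted hmd heq hlt hτ hγ
    exact ⟨h1, h2, h3, fun j _ hj r hr => FisherBingham.derivTau_eq_zero lam tau hj hr, h4, h5, h6⟩
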